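/- **Setting.** Let $E,F$ be complex Banach spaces, $U\subseteq E$ open, and $v\colon U\to(0,\infty)$ continuous. Let $\mathcal H^\infty_v(U,F)$ be the space of all holomorphic $f\colon U\to F$ with $\|f\|_v:=\sup_{x\in U}v(x)\|f(x)\|<\infty$, normed by $\|\cdot\|_v$, and write $\mathcal H^\infty_v(U)=\mathcal H^\infty_v(U,\mathbb C)$. Let $\mathcal G^\infty_v(U)\subseteq\mathcal H^\infty_v(U)^*$ be the space, with the dual norm, of all linear functionals on $\mathcal H^\infty_v(U)$ whose restriction to the closed unit ball is continuous for the compact-open topology; it contains the evaluations $\delta_x\colon g\mapsto g(x)$, $x\in U$. For $f\in\mathcal H^\infty_v(U,F)$, the linearization $T_f$ is the unique bounded linear operator $T_f\colon\mathcal G^\infty_v(U)\to F$ with $T_f(\delta_x)=f(x)$ for all $x\in U$. **Sets and operators of $p$-compact type.** For a sequence $(x_n)$ in $F$ and $1\le p<\infty$ put $\|(x_n)\|_p=(\sum_n\|x_n\|^p)^{1/p}$ and $\|(x_n)\|_p^w=\sup_{\varphi\in B_{F^*}}\|(\varphi(x_n))\|_p$, and let $\|(x_n)\|_\infty=\sup_n\|x_n\|$.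 Let $\ell_p(F)$ and $\ell_p^w(F)$ be the spaces of sequences for which $\|\cdot\|_p$, respectively $\|\cdot\|_p^w$, is finite, let $\ell^u_p(F)=\{(x_n)\in\ell_p^w(F)\colon\lim_m\|(x_n)_{n\ge m}\|^w_p=0\}$, and let $c_0(F)$ and $c_0^w(F)$ be the spaces of norm null and weakly null sequences. Put $p\text{-}\mathrm{conv}(x_n)=\{\sum_n a_nx_n\colon (a_n)\in B\}$, where $B$ is the closed unit ball of $c_0$ if $p=1$, of $\ell_{p^*}$ with $1/p+1/p^*=1$ if $1<p<\infty$, and of $\ell_1$ if $p=\infty$. Let $p\in[1,\infty]$ and let $\mathcal I$ be one of $\mathcal K_p,\mathcal K_{wp},\mathcal K_{up}$. Let $(s_{\mathcal I}(F),\|\cdot\|_{s_{\mathcal I}})$ be, respectively, $(\ell_p(F),\|\cdot\|_p)$, $(\ell_p^w(F),\|\cdot\|_p^w)$, $(\ell_p^u(F),\|\cdot\|_p^w)$ if $p<\infty$, and $c_0(F)$, $c_0^w(F)$, $c_0(F)$ with $\|\cdot\|_\infty$ if $p=\infty$. A set $K\subseteq F$ has the $\mathcal I$-property if $K\subseteq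 p\text{-}\mathrm{conv}(x_n)$ for some $(x_n)\in s_{\mathcal I}(F)$, and then $$m_{\mathcal I}(K)=\inf\{\|(x_n)\|_{s_{\mathcal I}}\colon (x_n)\in s_{\mathcal I}(F),\ K\subseteq p\text{-}\mathrm{conv}(x_n)\}.$$ For a normed space $X$, $\mathcal I(X,F)$ is the set of bounded linear operators $T\colon X\to F$ such that $T(B_X)$ has the $\mathcal I$-property, where $B_X$ is the closed unit ball, with $\|T\|_{\mathcal I}=m_{\mathcal I}(T(B_X))$. Finally, $\mathcal H^\infty_{v\mathcal I}(U,F)$ is the set of $f\in\mathcal H^\infty_v(U,F)$ such that $(vf)(U)=\{v(x)f(x)\colon x\in U\}$ has the $\mathcal I$-property, with $\|f\|_{\mathcal H^\infty_{v\mathcal I}}=m_{\mathcal I}((vf)(U))$. **Theorem.** Let $p\in[1,\infty]$ and $\mathcal I=\mathcal K_p,\mathcal K_{wp},\mathcal K_{up}$. Every $f\in\mathcal H^\infty_v(U,F)$ has a unique linearization $T_f$, which depends linearly on $f$, and $$f\in\mathcal H^\infty_{v\mathcal I}(U,F)\iff T_f\in\mathcal I(\mathcal G^\infty_v(U),F),$$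 in which case $\|f\|_{\mathcal H^\infty_{v\mathcal I}}=\|T_f\|_{\mathcal I}$. Furthermore, $f\mapsto T_f$ is an isometric isomorphism from $(\mathcal H^\infty_{v\mathcal I}(U,F),\|\cdot\|_{\mathcal H^\infty_{v\mathcal I}})$ onto $(\mathcal I(\mathcal G^\infty_v(U),F),\|\cdot\|_{\mathcal I})$, and both of these are Banach spaces. -/

import Mathlib

open Set Filter Topology
open scoped ENNReal

noncomputable section

namespace WeightedHolomorphic

/-! ### Sequences, `p`-convex hulls and sets of `p`-compact type -/

section Sequences

variable {F : Type*} [NormedAddCommGroup F] [NormedSpace ℂ F]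

/-- The `ℓ_p`-norm (supremum norm if `p = ∞`) of a vector-valued sequence, with value `∞` if the
sequence is not `p`-summable (not bounded). -/
def seqNorm {X : Type*} [NormedAddCommGroup X] (p : ℝ≥0∞) (x : ℕ → X) : ℝ≥0∞ :=
  if p = ∞ then ⨆ n, ‖x n‖ₑ else (∑' n, ‖x n‖ₑ ^ p.toReal) ^ (1 / p.toReal)

/-- The weak `ℓ_p`-norm `sup {‖(φ (x n))‖_p : φ ∈ B_{F^*}}`, possibly `∞`. -/
def weakSeqNorm (p : ℝ≥0∞) (x : ℕ → F) : ℝ≥0∞ :=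
  ⨆ φ ∈ Metric.closedBall (0 : StrongDual ℂ F) 1, seqNorm p (fun n => φ (x n))

/-- The coefficient sequences of the `p`-convex hull: the closed unit ball of `c_0` if `p = 1`, and
of `ℓ_{p^*}` if `p ∈ (1,∞]` (in particular of `ℓ_1` if `p = ∞`). -/
def coeffBall (p : ℝ≥0∞) : Set (ℕ → ℂ) :=
  if p = 1 then {a | Tendsto a atTop (𝓝 0) ∧ ∀ n, ‖a n‖ ≤ 1}
  else {a | seqNorm p.conjExponent a ≤ 1}

/-- The `p`-convex hull of a sequence. -/
def pConv (p : ℝ≥0∞) (x : ℕ → F) : Set F :=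
  {y | ∃ a ∈ coeffBall p, HasSum (fun n => a n • x n) y}

/-- The three types of `p`-compactness: `p`-compact, weakly `p`-compact and unconditionally
`p`-compact. -/
inductive Kind
  | strong
  | weak
  | uncond

/-- The sequences allowed for each type of `p`-compactness: those in `ℓ_p(F)`, `ℓ_p^w(F)`,
`ℓ_p^u(F)` for `p < ∞`, and those in `c_0(F)`, `c_0^w(F)`, `c_0(F)` for `p = ∞`. -/
def Admissible (i : Kind) (p : ℝ≥0∞) (x : ℕ → F) : Prop :=
  match i with
  | .strong => if p = ∞ then Tendsto x atTop (𝓝 0) else seqNorm p x < ∞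
  | .weak =>
      if p = ∞ then ∀ φ : StrongDual ℂ F, Tendsto (fun n => φ (x n)) atTop (𝓝 0)
      else weakSeqNorm p x < ∞
  | .uncond =>
      if p = ∞ then Tendsto x atTop (𝓝 0)
      else weakSeqNorm p x < ∞ ∧
        Tendsto (fun m => weakSeqNorm p (fun n => x (n + m))) atTop (𝓝 0)

/-- The norm of the sequence space used for each type: `‖·‖_p` for `p`-compactness, `‖·‖_p^w` for
the weak and the unconditional type, and the supremum norm in all cases if `p = ∞`. -/
def kindNorm (i : Kind) (p : ℝ≥0∞) (x : ℕ → F) : ℝ≥0∞ :=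
  if p = ∞ then seqNorm ∞ x
  else match i with
    | .strong => seqNorm p x
    | .weak => weakSeqNorm p x
    | .uncond => weakSeqNorm p x

/-- `K` is relatively `p`-compact, relatively weakly `p`-compact, or relatively unconditionally
`p`-compact. -/
def RelCompact (i : Kind) (p : ℝ≥0∞) (K : Set F) : Prop :=
  ∃ x : ℕ → F, Admissible i p x ∧ K ⊆ pConv p x

/-- The measure of the size of the `p`-compactness of `K`. The infimum is taken in `[0,∞]`; it is
finite for the sets with the corresponding property. -/
def measureSize (i : Kind) (p : ℝ≥0∞) (K : Set F) : ℝ :=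
  (⨅ (x : ℕ → F) (_ : Admissible i p x ∧ K ⊆ pConv p x), kindNorm i p x).toReal

/-- The class `𝓚_p(X,F)`, `𝓚_{wp}(X,F)` or `𝓚_{up}(X,F)` of bounded linear operators. -/
def opIdeal (i : Kind) (p : ℝ≥0∞) (X F : Type*) [NormedAddCommGroup X] [NormedSpace ℂ X]
    [NormedAddCommGroup F] [NormedSpace ℂ F] : Set (X →L[ℂ] F) :=
  {T | RelCompact i p (T '' Metric.closedBall 0 1)}

/-- The norm of the operator ideal. -/
def opIdealNorm (i : Kind) (p : ℝ≥0∞) (X F : Type*) [NormedAddCommGroup X] [NormedSpace ℂ X]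
    [NormedAddCommGroup F] [NormedSpace ℂ F] (T : X →L[ℂ] F) : ℝ :=
  measureSize i p (T '' Metric.closedBall 0 1)

end Sequences

/-! ### Weighted holomorphic mappings -/

section Weighted

variable {E : Type*} [NormedAddCommGroup E] [NormedSpace ℂ E]

/-- A weight on `U`: a strictly positive continuous function. -/
structure Weight (U : TopologicalSpace.Opens E) where
  toFun : U → ℝ
  continuous_toFun : Continuous toFun
  pos : ∀ x, 0 < toFun x

/-- A mapping on the open set `U` is holomorphic if it is the restriction of a mapping that is
complex Fréchet differentiable at every point of `U`. -/
def IsHolomorphic {U : TopologicalSpace.Opens E} {F : Type*} [NormedAddCommGroup F]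
    [NormedSpace ℂ F] (f : U → F) : Prop :=
  ∃ g : E → F, DifferentiableOn ℂ g U ∧ ∀ x : U, g x = f x

variable {U : TopologicalSpace.Opens E}

/-- The linear space underlying `𝓗_v^∞(U,F)`. -/
def hvSubmodule (v : Weight U) (F : Type*) [NormedAddCommGroup F] [NormedSpace ℂ F] :
    Submodule ℂ (U → F) where
  carrier := {f | IsHolomorphic f ∧ BddAbove (range fun x => v.toFun x * ‖f x‖)}
  zero_mem' := by
    refine ⟨⟨fun _ => 0, differentiableOn_const 0, fun _ => rfl⟩, 0, ?_⟩
    rintro _ ⟨x, rfl⟩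
    simp
  add_mem' := by
    rintro f₁ f₂ ⟨⟨g₁, hg₁, h₁⟩, C₁, hC₁⟩ ⟨⟨g₂, hg₂, h₂⟩, C₂, hC₂⟩
    refine ⟨⟨fun x => g₁ x + g₂ x, hg₁.add hg₂, fun x => by simp [h₁, h₂]⟩, C₁ + C₂, ?_⟩
    rintro _ ⟨x, rfl⟩
    have e₁ := hC₁ ⟨x, rfl⟩
    have e₂ := hC₂ ⟨x, rfl⟩
    have e₃ := mul_le_mul_of_nonneg_left (norm_add_le (f₁ x) (f₂ x)) (v.pos x).le
    simp only [Pi.add_apply] at e₁ e₂ ⊢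
    linarith
  smul_mem' := by
    rintro c f ⟨⟨g, hg, h⟩, C, hC⟩
    refine ⟨⟨fun x => c • g x, hg.const_smul c, fun x => by simp [h]⟩, ‖c‖ * C, ?_⟩
    rintro _ ⟨x, rfl⟩
    have e := mul_le_mul_of_nonneg_left (hC ⟨x, rfl⟩) (norm_nonneg c)
    simp only [Pi.smul_apply, norm_smul] at e ⊢
    linarith

/-- The space `𝓗_v^∞(U,F)` of weighted holomorphic mappings. -/
def Hv (v : Weight U) (F : Type*) [NormedAddCommGroup F] [NormedSpace ℂ F] : Type _ :=
  hvSubmodule v F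

variable {v : Weight U} {F : Type*} [NormedAddCommGroup F] [NormedSpace ℂ F]

instance : AddCommGroup (Hv v F) := inferInstanceAs (AddCommGroup (hvSubmodule v F))
instance : Module ℂ (Hv v F) := inferInstanceAs (Module ℂ (hvSubmodule v F))
instance : CoeFun (Hv v F) (fun _ => U → F) := ⟨fun f => f.1⟩

/-- The weighted supremum norm `‖f‖_v`. -/
instance : Norm (Hv v F) := ⟨fun f => ⨆ x, v.toFun x * ‖f x‖⟩

theorem Hv.norm_def (f : Hv v F) : ‖f‖ = ⨆ x, v.toFun x * ‖f x‖ := rfl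

theorem Hv.le_norm (f : Hv v F) (x : U) : v.toFun x * ‖f x‖ ≤ ‖f‖ :=
  le_ciSup f.2.2 x

theorem Hv.norm_nonneg' (f : Hv v F) : 0 ≤ ‖f‖ :=
  Real.iSup_nonneg fun x => mul_nonneg (v.pos x).le (norm_nonneg _)

theorem Hv.norm_le {f : Hv v F} {C : ℝ} (hC : 0 ≤ C) (h : ∀ x, v.toFun x * ‖f x‖ ≤ C) :
    ‖f‖ ≤ C :=
  Real.iSup_le h hC

theorem Hv.normCore : NormedSpace.Core ℂ (Hv v F) where
  norm_nonneg f := f.norm_nonneg'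
  norm_smul c f := by
    have key : ∀ x, v.toFun x * ‖(c • f) x‖ = ‖c‖ * (v.toFun x * ‖f x‖) := fun x => by
      have : (c • f) x = c • f x := rfl
      rw [this, norm_smul]
      ring
    rw [Hv.norm_def, Hv.norm_def, Real.mul_iSup_of_nonneg (norm_nonneg c)]
    simp only [key]
  norm_triangle f g := by
    refine Hv.norm_le (add_nonneg f.norm_nonneg' g.norm_nonneg') fun x => ?_
    have e : (f + g) x = f x + g x := rfl
    have e₁ := mul_le_mul_of_nonneg_left (norm_add_le (f x) (g x)) (v.pos x).le
    have e₂ := f.le_norm x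
    have e₃ := g.le_norm x
    rw [e]
    linarith
  norm_eq_zero_iff f := by
    constructor
    · intro h
      refine Subtype.ext (funext fun x => ?_)
      have e := f.le_norm x
      rw [h] at e
      have e₂ : ‖f x‖ ≤ 0 := nonpos_of_mul_nonpos_right e (v.pos x)
      exact norm_le_zero_iff.1 e₂
    · rintro rfl
      refine le_antisymm (Hv.norm_le le_rfl fun x => ?_) (Hv.norm_nonneg' _)
      have : (0 : Hv v F) x = 0 := rfl
      simp [this]

instance : NormedAddCommGroup (Hv v F) := NormedAddCommGroup.ofCore Hv.normCore
instance : NormedSpace ℂ (Hv v F) := NormedSpace.ofCore Hv.normCore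

theorem Hv.continuous_coe (f : Hv v F) : Continuous (fun x : U => f x) := by
  obtain ⟨g, hg, h⟩ := f.2.1
  have e : (fun x : U => f x) = (U : Set E).domRestrict g := funext fun x => (h x).symm
  rw [e]
  exact hg.continuousOn.domRestrict

/-- The compact-open topology on the closed unit ball of `𝓗_v^∞(U)`. -/
abbrev ballCompactOpen (v : Weight U) :
    TopologicalSpace (Metric.closedBall (0 : Hv v ℂ) 1) :=
  TopologicalSpace.induced
    (fun f => (⟨fun x => f.1 x, f.1.continuous_coe⟩ : C(U, ℂ))) ContinuousMap.compactOpen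

/-- The space `𝓖_v^∞(U)` of the linear functionals on `𝓗_v^∞(U)` whose restriction to the closed
unit ball is continuous for the compact-open topology, with the norm of the dual space. (Such
functionals are automatically bounded, because the norm topology of `𝓗_v^∞(U)` is finer than the
compact-open topology.) -/
def Gv (v : Weight U) : Submodule ℂ (StrongDual ℂ (Hv v ℂ)) where
  carrier := {φ | Continuous[ballCompactOpen v, inferInstance]
    (fun f : Metric.closedBall (0 : Hv v ℂ) 1 => φ f.1)}
  zero_mem' := by
    let _ := ballCompactOpen v
    exact continuous_const
  add_mem' := by
    let _ := ballCompactOpen v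
    intro φ ψ hφ hψ
    exact Continuous.add (M := ℂ) hφ hψ
  smul_mem' := by
    let _ := ballCompactOpen v
    intro c φ hφ
    exact Continuous.const_smul (α := ℂ) hφ c

/-- The mapping `Δ_v : U → 𝓖_v^∞(U)`, which sends `x` to the evaluation functional `δ_x`. -/
def delta (v : Weight U) (x : U) : Gv v :=
  ⟨LinearMap.mkContinuous
      { toFun := fun f : Hv v ℂ => f x
        map_add' := fun _ _ => rfl
        map_smul' := fun _ _ => rfl }
      (v.toFun x)⁻¹ (fun f => by
        rw [inv_mul_eq_div, le_div_iff₀ (v.pos x), mul_comm]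
        exact f.le_norm x), by
    let _ := ballCompactOpen v
    have h : Continuous (fun f : Metric.closedBall (0 : Hv v ℂ) 1 =>
        (⟨fun x => f.1 x, f.1.continuous_coe⟩ : C(U, ℂ))) := continuous_induced_dom
    exact (continuous_eval_const (F := C(U, ℂ)) x).comp h⟩

theorem delta_apply (x : U) (f : Hv v ℂ) : (delta v x : StrongDual ℂ (Hv v ℂ)) f = f x := rfl

/-- `T` is a linearization of `f`: a bounded linear operator with `T ∘ Δ_v = f`. -/
def IsLinearization (f : Hv v F) (T : Gv v →L[ℂ] F) : Prop :=
  ∀ x : U, T (delta v x) = f x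

/-- The `v`-range `(vf)(U)`. -/
def vRange (f : Hv v F) : Set F :=
  range fun x : U => (v.toFun x : ℂ) • f x

/-- The class `𝓗_{v𝓘}^∞(U,F)` for `𝓘 = 𝓚_p, 𝓚_{wp}, 𝓚_{up}`. -/
def hvIdeal (i : Kind) (p : ℝ≥0∞) (v : Weight U) (F : Type*) [NormedAddCommGroup F]
    [NormedSpace ℂ F] : Set (Hv v F) :=
  {f | RelCompact i p (vRange f)}

/-- The norm of `𝓗_{v𝓘}^∞(U,F)`. -/
def hvIdealNorm (i : Kind) (p : ℝ≥0∞) (f : Hv v F) : ℝ :=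
  measureSize i p (vRange f)

end Weighted

/-- The subset `S` of the complex vector space `X`, with the function `N`, is a Banach space:
`S` is a linear subspace, `N` is a norm on `S`, and `S` is complete for this norm. -/
structure IsBanachOn {X : Type*} [AddCommGroup X] [Module ℂ X] (S : Set X) (N : X → ℝ) :
    Prop where
  zero_mem : (0 : X) ∈ S
  add_mem : ∀ x ∈ S, ∀ y ∈ S, x + y ∈ S
  smul_mem : ∀ (c : ℂ), ∀ x ∈ S, c • x ∈ S
  nonneg : ∀ x ∈ S, 0 ≤ N x
  eq_zero_iff : ∀ x ∈ S, (N x = 0 ↔ x = 0)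
  smul : ∀ (c : ℂ), ∀ x ∈ S, N (c • x) = ‖c‖ * N x
  triangle : ∀ x ∈ S, ∀ y ∈ S, N (x + y) ≤ N x + N y
  complete : ∀ u : ℕ → X, (∀ n, u n ∈ S) →
    (∀ ε > 0, ∃ n₀, ∀ m ≥ n₀, ∀ n ≥ n₀, N (u m - u n) < ε) →
    ∃ x ∈ S, Tendsto (fun n => N (u n - x)) atTop (𝓝 0)

end WeightedHolomorphic

end

noncomputable section

namespace WeightedHolomorphic

open MeasureTheory

/-! ### Scalar and vector-valued `ℓ_p`-sequences -/

section SeqNorm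

variable {X Y : Type*} [NormedAddCommGroup X] [NormedAddCommGroup Y]

/-! Write `G` for the space of functionals and `δ_x` for the evaluations. Linearization: `φ ↦ (u ↦ φ
(u ∘ f))` maps `G` boundedly into the bidual of `F` and sends `δ_x` to `f x`. The `δ_x` span a dense
subspace (`dense_span_eval`) and `F`, being complete, is closed in its bidual, so the values lie in
`F`. Conversely `x ↦ δ_x` is holomorphic (`differentiableOn_eval`), so every bounded operator on `G`
is a linearization. Density and holomorphy both rest on Schwarz estimates that are uniform on the
unit ball of the weighted space.

Equivalence and norms: `v(x) δ_x` lies in the unit ball of `G`, so the `v`-range of `f` is part of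
the image of that ball under `T_f`. In the other direction, Hahn–Banach makes the unit ball part of
the closed convex hull of the multiples `c v(x) δ_x`, `|c| ≤ 1`. Closedness of `p`-convex hulls is
never needed: they are stable under absolutely convex series (`hasSum_smul_mem_pConv`), and
successive approximation writes each `φ` in the ball as `∑ ε^k a_k` with `a_k` in the convex hull.
Hence `(1 - ε) T_f φ` stays in any `p`-convex hull that contains the `v`-range
(`smul_apply_mem_of_eval`), and `ε → 0` gives equal norms.

Banach property: sets lying in countably many `p`-convex hulls are added by concatenating the
sequences. If the `k`-th sequence has norm at most `μ_k` and the coefficients lie in the `ℓ_{p*}`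
ball, the concatenation has norm at most `‖μ‖_p` (`measureSize_le_of_series`). Suitable splittings
of the weights give the triangle inequality and completeness for operators; the linear bijection `f
↦ T_f` carries both over to mappings. -/

theorem seqNorm_top (x : ℕ → X) : seqNorm ∞ x = ⨆ n, ‖x n‖ₑ := if_pos rfl

theorem seqNorm_of_ne_top {p : ℝ≥0∞} (hp : p ≠ ∞) (x : ℕ → X) :
    seqNorm p x = (∑' n, ‖x n‖ₑ ^ p.toReal) ^ (1 / p.toReal) := if_neg hp

/-- Counting measure makes Hölder, Minkowski and Fatou available for sequences. The exponent `0` is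
excluded because there the left side is `1` and the right side is `0`. -/
theorem seqNorm_eq_eLpNorm {p : ℝ≥0∞} (hp : p ≠ 0) (x : ℕ → X) :
    seqNorm p x = eLpNorm x p Measure.count := by
  by_cases h : p = ∞
  · subst h
    rw [seqNorm_top, eLpNorm_exponent_top, eLpNormEssSup_count]
  · rw [seqNorm_of_ne_top h, eLpNorm_eq_lintegral_rpow_enorm_toReal hp h, lintegral_count]

theorem toReal_pos_of_one_le {p : ℝ≥0∞} (hp : 1 ≤ p) (h : p ≠ ∞) : 0 < p.toReal :=
  ENNReal.toReal_pos (zero_lt_one.trans_le hp).ne' h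

theorem seqNorm_rpow {p : ℝ≥0∞} (hp : 1 ≤ p) (h : p ≠ ∞) (x : ℕ → X) :
    seqNorm p x ^ p.toReal = ∑' n, ‖x n‖ₑ ^ p.toReal := by
  rw [seqNorm_of_ne_top h, ← ENNReal.rpow_mul, one_div_mul_cancel (toReal_pos_of_one_le hp h).ne',
    ENNReal.rpow_one]

theorem seqNorm_mono {p : ℝ≥0∞} {x : ℕ → X} {y : ℕ → Y} (h : ∀ n, ‖x n‖ₑ ≤ ‖y n‖ₑ) :
    seqNorm p x ≤ seqNorm p y := by
  unfold seqNorm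
  split_ifs
  · exact iSup_mono h
  · gcongr with n
    exact h n

theorem enorm_le_seqNorm {p : ℝ≥0∞} (hp : 1 ≤ p) (x : ℕ → X) (n : ℕ) : ‖x n‖ₑ ≤ seqNorm p x := by
  by_cases h : p = ∞
  · subst h
    rw [seqNorm_top]
    exact le_iSup (fun n => ‖x n‖ₑ) n
  · have hp' := toReal_pos_of_one_le hp h
    rw [← ENNReal.rpow_le_rpow_iff hp', seqNorm_rpow hp h]
    exact ENNReal.le_tsum (f := fun n => ‖x n‖ₑ ^ p.toReal) n

theorem seqNorm_const_smul [NormedSpace ℂ X] {p : ℝ≥0∞} (hp : 1 ≤ p) (c : ℂ) (x : ℕ → X) :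
    seqNorm p (fun n => c • x n) = ‖c‖ₑ * seqNorm p x := by
  have hp0 := (zero_lt_one.trans_le hp).ne'
  rw [seqNorm_eq_eLpNorm hp0, seqNorm_eq_eLpNorm hp0]
  exact eLpNorm_const_smul c x p Measure.count

theorem seqNorm_le_tsum {p : ℝ≥0∞} (hp : 1 ≤ p) (x : ℕ → X) : seqNorm p x ≤ ∑' n, ‖x n‖ₑ := by
  by_cases h : p = ∞
  · subst h
    rw [seqNorm_top]
    exact iSup_le fun n => ENNReal.le_tsum n
  · have hp' := toReal_pos_of_one_le hp h
    have hp1 : 1 ≤ p.toReal := by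
      rw [← ENNReal.toReal_one]
      exact ENNReal.toReal_mono h hp
    by_cases hS : ∑' n, ‖x n‖ₑ = ∞
    · rw [hS]
      exact le_top
    rw [← ENNReal.rpow_le_rpow_iff hp', seqNorm_rpow hp h]
    set S := ∑' n, ‖x n‖ₑ with hSdef
    -- One factor of each term is kept and the other `p - 1` factors are bounded by the whole sum
    -- `S`.
    calc ∑' n, ‖x n‖ₑ ^ p.toReal ≤ ∑' n, ‖x n‖ₑ * S ^ (p.toReal - 1) := by
          refine ENNReal.tsum_le_tsum fun n => ?_
          have e : ‖x n‖ₑ ≤ S := ENNReal.le_tsum n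
          calc ‖x n‖ₑ ^ p.toReal = ‖x n‖ₑ ^ (1 + (p.toReal - 1)) := by ring_nf
            _ = ‖x n‖ₑ * ‖x n‖ₑ ^ (p.toReal - 1) := by
              rw [ENNReal.rpow_add_of_nonneg _ _ zero_le_one (by linarith), ENNReal.rpow_one]
            _ ≤ _ := by
              gcongr
      _ = S * S ^ (p.toReal - 1) := ENNReal.tsum_mul_right
      _ = S ^ p.toReal := by
        nth_rw 1 [← ENNReal.rpow_one S]
        rw [← ENNReal.rpow_add_of_nonneg _ _ zero_le_one (by linarith)]
        ring_nf

/-- Hölder's inequality for sequences. -/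
theorem tsum_enorm_smul_le {p q : ℝ≥0∞} (hp : 1 ≤ p) (hq : 1 ≤ q) [ENNReal.HolderConjugate q p]
    (a : ℕ → ℂ) (b : ℕ → ℂ) : ∑' n, ‖a n • b n‖ₑ ≤ seqNorm q a * seqNorm p b := by
  have h1 : ∑' n, ‖a n • b n‖ₑ = eLpNorm (a • b) 1 Measure.count := by
    rw [eLpNorm_one_eq_lintegral_enorm, lintegral_count]
    rfl
  rw [h1, seqNorm_eq_eLpNorm (zero_lt_one.trans_le hp).ne',
    seqNorm_eq_eLpNorm (zero_lt_one.trans_le hq).ne']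
  exact eLpNorm_smul_le_mul_eLpNorm (Measurable.of_discrete).aestronglyMeasurable
    (Measurable.of_discrete).aestronglyMeasurable

/-- Fatou's lemma: the norm is lower semicontinuous under coordinatewise convergence. -/
theorem seqNorm_lim_le {r C : ℝ≥0∞} (hr : 1 ≤ r) {a : ℕ → ℕ → ℂ} {b : ℕ → ℂ}
    (h : ∀ n, Tendsto (fun K => a K n) atTop (𝓝 (b n))) (hC : ∀ K, seqNorm r (a K) ≤ C) :
    seqNorm r b ≤ C := by
  have hr0 := (zero_lt_one.trans_le hr).ne'
  simp only [seqNorm_eq_eLpNorm hr0] at hC ⊢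
  refine (Lp.eLpNorm_lim_le_liminf_eLpNorm
    (fun K => (Measurable.of_discrete (f := a K)).aestronglyMeasurable) b
    (Eventually.of_forall h)).trans ?_
  exact liminf_le_of_frequently_le' (Frequently.of_forall hC)

theorem seqNorm_sum_le {r : ℝ≥0∞} (hr : 1 ≤ r) (a : ℕ → ℕ → ℂ) (s : Finset ℕ) :
    seqNorm r (fun n => ∑ k ∈ s, a k n) ≤ ∑ k ∈ s, seqNorm r (a k) := by
  have hr0 := (zero_lt_one.trans_le hr).ne'
  simp only [seqNorm_eq_eLpNorm hr0]
  have := eLpNorm_sum_le (f := a) (s := s) (μ := Measure.count) (p := r)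
    (fun k _ => (Measurable.of_discrete (f := a k)).aestronglyMeasurable) hr
  convert this using 2
  ext n
  simp

/-- The sequences in `ℓ_r` if `r < ∞`, and those in `c_0` if `r = ∞`. -/
def IsLpNull (r : ℝ≥0∞) (x : ℕ → X) : Prop :=
  seqNorm r x < ∞ ∧ (r = ∞ → Tendsto x atTop (𝓝 0))

/-- Dominated convergence for sequences of sequences. -/
theorem tendsto_seqNorm_of_dominated {ι : Type*} {l : Filter ι} [l.IsCountablyGenerated]
    {r : ℝ≥0∞} (hr : 1 ≤ r) {a : ℕ → X} (ha : IsLpNull r a) {w : ι → ℕ → Y}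
    (hw : ∀ i n, ‖w i n‖ₑ ≤ ‖a n‖ₑ) (h0 : ∀ n, Tendsto (fun i => w i n) l (𝓝 0)) :
    Tendsto (fun i => seqNorm r (w i)) l (𝓝 0) := by
  by_cases h : r = ∞
  · subst h
    rw [ENNReal.tendsto_nhds_zero]
    intro ε hε
    have ht := (continuous_enorm.tendsto (0 : X)).comp (ha.2 rfl)
    rw [enorm_zero, ENNReal.tendsto_nhds_zero] at ht
    -- For `r = ∞` domination alone would not suffice. As `a` is null, it controls all coordinates
    -- from `N` on, and only finitely many remain.
    obtain ⟨N, hN⟩ := eventually_atTop.1 (ht ε hε)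
    have hfin : ∀ᶠ i in l, ∀ n ∈ Finset.range N, ‖w i n‖ₑ ≤ ε := by
      rw [Filter.eventually_all_finset]
      intro n _
      have := (continuous_enorm.tendsto (0 : Y)).comp (h0 n)
      rw [enorm_zero, ENNReal.tendsto_nhds_zero] at this
      exact this ε hε
    filter_upwards [hfin] with i hi
    rw [seqNorm_top]
    refine iSup_le fun n => ?_
    by_cases hn : n < N
    · exact hi n (Finset.mem_range.2 hn)
    · exact (hw i n).trans (hN n (not_lt.1 hn))
  · have hr' := toReal_pos_of_one_le hr h
    have key : Tendsto (fun i => ∫⁻ n, ‖w i n‖ₑ ^ r.toReal ∂(Measure.count : Measure ℕ)) l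
        (𝓝 (∫⁻ _, 0 ∂(Measure.count : Measure ℕ))) := by
      refine tendsto_lintegral_filter_of_dominated_convergence (fun n => ‖a n‖ₑ ^ r.toReal)
        (Eventually.of_forall fun i => Measurable.of_discrete)
        (Eventually.of_forall fun i => Eventually.of_forall fun n => ?_) ?_
        (Eventually.of_forall fun n => ?_)
      · exact ENNReal.rpow_le_rpow (hw i n) hr'.le
      · rw [lintegral_count, ← seqNorm_rpow hr h]
        exact (ENNReal.rpow_lt_top_of_nonneg hr'.le ha.1.ne).ne
      · have := ((continuous_enorm.tendsto (0 : Y)).comp (h0 n)).ennrpow_const r.toReal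
        simpa [ENNReal.zero_rpow_of_pos hr'] using this
    simp only [lintegral_count, lintegral_zero] at key
    have := key.ennrpow_const (1 / r.toReal)
    rw [ENNReal.zero_rpow_of_pos (by positivity)] at this
    simpa only [seqNorm_of_ne_top h] using this

theorem IsLpNull.const_smul [NormedSpace ℂ X] {r : ℝ≥0∞} (hr : 1 ≤ r) {x : ℕ → X}
    (h : IsLpNull r x) (c : ℂ) : IsLpNull r (fun n => c • x n) := by
  refine ⟨?_, fun h' => by simpa using (h.2 h').const_smul c⟩
  rw [seqNorm_const_smul hr]
  exact ENNReal.mul_lt_top enorm_lt_top h.1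

/-- The concatenation of a sequence of sequences. -/
def concat {Z : Type*} (z : ℕ → ℕ → Z) (m : ℕ) : Z := z m.unpair.1 m.unpair.2

theorem seqNorm_concat_le {p : ℝ≥0∞} (hp : 1 ≤ p) {z : ℕ → ℕ → X} {μ : ℕ → Y}
    (h : ∀ k, seqNorm p (z k) ≤ ‖μ k‖ₑ) : seqNorm p (concat z) ≤ seqNorm p μ := by
  by_cases hp' : p = ∞
  · subst hp'
    simp only [seqNorm_top] at h ⊢
    refine iSup_le fun m => ?_
    exact ((le_iSup (fun n => ‖z m.unpair.1 n‖ₑ) m.unpair.2).trans (h _)).trans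
      (le_iSup (fun k => ‖μ k‖ₑ) _)
  · have hpos := toReal_pos_of_one_le hp hp'
    rw [← ENNReal.rpow_le_rpow_iff hpos, seqNorm_rpow hp hp', seqNorm_rpow hp hp']
    have e : ∑' m, ‖concat z m‖ₑ ^ p.toReal = ∑' kn : ℕ × ℕ, ‖z kn.1 kn.2‖ₑ ^ p.toReal :=
      Nat.pairEquiv.symm.tsum_eq (fun kn : ℕ × ℕ => ‖z kn.1 kn.2‖ₑ ^ p.toReal)
    rw [e, ENNReal.tsum_prod']
    refine ENNReal.tsum_le_tsum fun k => ?_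
    rw [← seqNorm_rpow hp hp' (z k)]
    exact ENNReal.rpow_le_rpow (h k) hpos.le

theorem IsLpNull.concat {p : ℝ≥0∞} (hp : 1 ≤ p) {z : ℕ → ℕ → X} {μ : ℕ → Y}
    (hμ : IsLpNull p μ) (hz : ∀ k, IsLpNull p (z k)) (h : ∀ k, seqNorm p (z k) ≤ ‖μ k‖ₑ) :
    IsLpNull p (concat z) := by
  refine ⟨(seqNorm_concat_le hp h).trans_lt hμ.1, fun hp' => ?_⟩
  have key : Tendsto (fun kn : ℕ × ℕ => z kn.1 kn.2) cofinite (𝓝 0) := by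
    rw [Metric.tendsto_nhds]
    intro ε hε
    have h1 : ∀ k, {n | ¬ dist (z k n) 0 < ε}.Finite := fun k => by
      have := (hz k).2 hp'
      rw [← Nat.cofinite_eq_atTop, Metric.tendsto_nhds] at this
      exact this ε hε
    have h2 : {k | ¬ dist (μ k) 0 < ε}.Finite := by
      have := hμ.2 hp'
      rw [← Nat.cofinite_eq_atTop, Metric.tendsto_nhds] at this
      exact this ε hε
    -- An entry of size at least `ε` lies in one of the finitely many rows with `‖μ k‖ ≥ ε`, and
    -- each row has only finitely many such entries.
    refine (h2.biUnion fun k _ => (h1 k).image (fun n => (k, n))).subset ?_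
    rintro ⟨k, n⟩ hkn
    have e : ‖z k n‖ ≤ ‖μ k‖ := by
      have := (enorm_le_seqNorm hp (z k) n).trans (h k)
      rwa [enorm_le_iff_norm_le] at this
    simp only [dist_zero_right] at hkn ⊢
    simp only [mem_ofPred_eq, mem_compl_iff, not_lt, mem_iUnion, mem_image] at hkn ⊢
    exact ⟨k, hkn.trans e, n, hkn, rfl⟩
  have := key.comp Nat.pairEquiv.symm.injective.tendsto_cofinite
  rwa [Nat.cofinite_eq_atTop] at this

end SeqNorm

/-! ### The coefficient ball -/

section CoeffBall

variable {p : ℝ≥0∞}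

theorem one_le_conjExponent (p : ℝ≥0∞) : 1 ≤ p.conjExponent := le_self_add

theorem conjExponent_eq_top_iff (hp : 1 ≤ p) : p.conjExponent = ∞ ↔ p = 1 := by
  simp only [ENNReal.conjExponent, ENNReal.add_eq_top, ENNReal.one_ne_top, false_or,
    ENNReal.inv_eq_top, tsub_eq_zero_iff_le]
  exact ⟨fun h => le_antisymm h hp, fun h => h.le⟩

/-- Since `p* = ∞` exactly when `p = 1`, the clause of `IsLpNull` for the exponent `∞` reproduces
the `c_0` convention, and later proofs need no case distinction. -/
theorem mem_coeffBall_iff (hp : 1 ≤ p) {a : ℕ → ℂ} :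
    a ∈ coeffBall p ↔ IsLpNull p.conjExponent a ∧ seqNorm p.conjExponent a ≤ 1 := by
  by_cases h : p = 1
  · have h' := (conjExponent_eq_top_iff hp).2 h
    simp only [coeffBall, if_pos h, IsLpNull, h', seqNorm_top, mem_ofPred_eq, iSup_le_iff,
      forall_const]
    constructor
    · rintro ⟨h1, h2⟩
      have h3 : ⨆ n, ‖a n‖ₑ ≤ 1 := iSup_le fun n => by
        rw [← enorm_one (G := ℂ), enorm_le_iff_norm_le]; simpa using h2 n
      exact ⟨⟨h3.trans_lt ENNReal.one_lt_top, h1⟩, fun n => (le_iSup _ n).trans h3⟩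
    · rintro ⟨⟨_, h1⟩, h2⟩
      refine ⟨h1, fun n => ?_⟩
      have := h2 n
      rw [← enorm_one (G := ℂ), enorm_le_iff_norm_le] at this
      simpa using this
  · have h' := (conjExponent_eq_top_iff hp).not.2 h
    simp only [coeffBall, if_neg h, IsLpNull, mem_ofPred_eq, h', IsEmpty.forall_iff, and_true]
    exact ⟨fun h => ⟨h.trans_lt ENNReal.one_lt_top, h⟩, fun h => h.2⟩

theorem norm_le_one_of_mem_coeffBall (hp : 1 ≤ p) {a : ℕ → ℂ} (ha : a ∈ coeffBall p) (n : ℕ) :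
    ‖a n‖ ≤ 1 := by
  have := (enorm_le_seqNorm (one_le_conjExponent p) a n).trans ((mem_coeffBall_iff hp).1 ha).2
  rw [← enorm_one (G := ℂ), enorm_le_iff_norm_le] at this
  simpa using this

/-- The coefficient ball is closed under absolutely convex series. -/
theorem tsum_mem_coeffBall (hp : 1 ≤ p) {c : ℕ → ℂ} (hc : Summable fun k => ‖c k‖)
    (hc1 : ∑' k, ‖c k‖ ≤ 1) {a : ℕ → ℕ → ℂ} (ha : ∀ k, a k ∈ coeffBall p) :
    (fun n => ∑' k, c k * a k n) ∈ coeffBall p := by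
  have hq := one_le_conjExponent p
  have hbd : ∀ k n, ‖c k * a k n‖ ≤ ‖c k‖ := fun k n => by
    rw [norm_mul]
    exact mul_le_of_le_one_right (norm_nonneg _) (norm_le_one_of_mem_coeffBall hp (ha k) n)
  have hs : ∀ n, Summable fun k => c k * a k n := fun n =>
    Summable.of_norm_bounded hc fun k => hbd k n
  rw [mem_coeffBall_iff hp]
  have hle : seqNorm p.conjExponent (fun n => ∑' k, c k * a k n) ≤ 1 := by
    refine seqNorm_lim_le hq (a := fun K n => ∑ k ∈ Finset.range K, c k * a k n)
      (fun n => (hs n).hasSum.tendsto_sum_nat) fun K => ?_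
    calc _ ≤ ∑ k ∈ Finset.range K, seqNorm p.conjExponent (fun n => c k * a k n) :=
          seqNorm_sum_le hq (fun k n => c k * a k n) _
      _ ≤ ∑ k ∈ Finset.range K, ‖c k‖ₑ := by
          refine Finset.sum_le_sum fun k _ => ?_
          have := seqNorm_const_smul hq (c k) (a k)
          simp only [smul_eq_mul] at this
          rw [this]
          exact mul_le_of_le_one_right' ((mem_coeffBall_iff hp).1 (ha k)).2
      _ = ENNReal.ofReal (∑ k ∈ Finset.range K, ‖c k‖) := by
          rw [ENNReal.ofReal_sum_of_nonneg fun _ _ => norm_nonneg _]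
          simp [ofReal_norm]
      _ ≤ 1 := by
          rw [← ENNReal.ofReal_one]
          exact ENNReal.ofReal_le_ofReal
            ((hc.sum_le_tsum _ fun _ _ => norm_nonneg _).trans hc1)
  refine ⟨⟨hle.trans_lt ENNReal.one_lt_top, fun ht => ?_⟩, hle⟩
  -- For `p = 1` the combined coefficients must still tend to zero: dominated convergence in `k`,
  -- with majorant `‖c k‖`.
  have := tendsto_tsum_of_dominated_convergence (𝓕 := atTop) (f := fun n k => c k * a k n)
    (g := fun _ => (0 : ℂ)) hc
    (fun k => by simpa using (((mem_coeffBall_iff hp).1 (ha k)).1.2 ht).const_mul (c k))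
    (Eventually.of_forall fun n k => hbd k n)
  simpa using this

/-- Concatenation of coefficient sequences. -/
theorem concat_mem_coeffBall (hp : 1 ≤ p) {c : ℕ → ℂ} (hc : c ∈ coeffBall p) {a : ℕ → ℕ → ℂ}
    (ha : ∀ k, a k ∈ coeffBall p) : concat (fun k n => c k * a k n) ∈ coeffBall p := by
  have hq := one_le_conjExponent p
  rw [mem_coeffBall_iff hp] at hc ⊢
  have h : ∀ k, seqNorm p.conjExponent (fun n => c k * a k n) ≤ ‖c k‖ₑ := fun k => by
    have := seqNorm_const_smul hq (c k) (a k)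
    simp only [smul_eq_mul] at this
    rw [this]
    exact mul_le_of_le_one_right' ((mem_coeffBall_iff hp).1 (ha k)).2
  exact ⟨hc.1.concat hq (fun k => ((mem_coeffBall_iff hp).1 (ha k)).1.const_smul hq (c k)) h,
    (seqNorm_concat_le hq h).trans hc.2⟩

end CoeffBall

/-! ### The weak norm and convergence of the series defining `p`-convex hulls -/

section Weak

variable {F : Type*} [NormedAddCommGroup F] [NormedSpace ℂ F] {p : ℝ≥0∞}

theorem weakSeqNorm_le_iff {x : ℕ → F} {C : ℝ≥0∞} :
    weakSeqNorm p x ≤ C ↔ ∀ φ : StrongDual ℂ F, ‖φ‖ ≤ 1 → seqNorm p (fun n => φ (x n)) ≤ C := by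
  simp [weakSeqNorm]

theorem seqNorm_le_weakSeqNorm (x : ℕ → F) {φ : StrongDual ℂ F} (hφ : ‖φ‖ ≤ 1) :
    seqNorm p (fun n => φ (x n)) ≤ weakSeqNorm p x :=
  weakSeqNorm_le_iff.1 le_rfl φ hφ

theorem enorm_apply_le {φ : StrongDual ℂ F} (hφ : ‖φ‖ ≤ 1) (y : F) : ‖φ y‖ₑ ≤ ‖y‖ₑ :=
  enorm_le_iff_norm_le.2 ((φ.le_opNorm y).trans (mul_le_of_le_one_left (norm_nonneg _) hφ))

theorem weakSeqNorm_le_seqNorm (x : ℕ → F) : weakSeqNorm p x ≤ seqNorm p x :=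
  weakSeqNorm_le_iff.2 fun _ hφ => seqNorm_mono fun n => enorm_apply_le hφ (x n)

theorem enorm_le_weakSeqNorm (hp : 1 ≤ p) (x : ℕ → F) (n : ℕ) : ‖x n‖ₑ ≤ weakSeqNorm p x := by
  obtain ⟨φ, hφ, h⟩ := exists_dual_vector'' ℂ (x n)
  refine le_trans ?_ ((enorm_le_seqNorm hp _ n).trans (seqNorm_le_weakSeqNorm x hφ))
  rw [h, enorm_le_iff_norm_le]
  simp

/-- Norming functionals recover each `‖x n‖`. Hence the supremum norm prescribed for `p = ∞` agrees
with the general weak norm. -/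
theorem weakSeqNorm_top (x : ℕ → F) : weakSeqNorm ∞ x = seqNorm ∞ x := by
  refine le_antisymm (weakSeqNorm_le_seqNorm x) ?_
  rw [seqNorm_top]
  exact iSup_le fun n => enorm_le_weakSeqNorm le_top x n

theorem weakSeqNorm_mono {x y : ℕ → F} (h : ∀ n, ∃ c : ℂ, ‖c‖ ≤ 1 ∧ x n = c • y n) :
    weakSeqNorm p x ≤ weakSeqNorm p y := by
  refine weakSeqNorm_le_iff.2 fun φ hφ => (seqNorm_mono fun n => ?_).trans
    (seqNorm_le_weakSeqNorm y hφ)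
  obtain ⟨c, hc, e⟩ := h n
  rw [e, enorm_le_iff_norm_le, map_smul, norm_smul]
  exact mul_le_of_le_one_left (norm_nonneg _) hc

theorem weakSeqNorm_const_smul_le (hp : 1 ≤ p) (c : ℂ) (x : ℕ → F) :
    weakSeqNorm p (fun n => c • x n) ≤ ‖c‖ₑ * weakSeqNorm p x := by
  refine weakSeqNorm_le_iff.2 fun φ hφ => ?_
  simp only [map_smul]
  rw [seqNorm_const_smul hp]
  gcongr
  exact seqNorm_le_weakSeqNorm x hφ

theorem holderConjugate_conjExponent (hp : 1 ≤ p) : ENNReal.HolderConjugate p.conjExponent p :=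
  (ENNReal.HolderConjugate.conjExponent hp).symm

/-- A norming functional for the sum reduces this to the scalar Hölder inequality. The indicator
retains only the coefficients in use, which makes this a Cauchy estimate. -/
theorem enorm_sum_smul_le (hp : 1 ≤ p) (x : ℕ → F) (a : ℕ → ℂ) (s : Finset ℕ) :
    ‖∑ n ∈ s, a n • x n‖ₑ ≤
      seqNorm p.conjExponent ((s : Set ℕ).indicator a) * weakSeqNorm p x := by
  have := holderConjugate_conjExponent hp
  obtain ⟨φ, hφ, h⟩ := exists_dual_vector'' ℂ (∑ n ∈ s, a n • x n)
  calc ‖∑ n ∈ s, a n • x n‖ₑ = ‖φ (∑ n ∈ s, a n • x n)‖ₑ := by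
        rw [h, ← ofReal_norm, ← ofReal_norm (_ : ℂ)]; simp
    _ = ‖∑ n ∈ s, a n • φ (x n)‖ₑ := by simp
    _ ≤ ∑ n ∈ s, ‖a n • φ (x n)‖ₑ := enorm_sum_le _ _
    _ = ∑ n ∈ s, ‖(s : Set ℕ).indicator a n • φ (x n)‖ₑ := by
        refine Finset.sum_congr rfl fun n hn => ?_
        rw [indicator_of_mem (by simpa using hn)]
    _ ≤ ∑' n, ‖(s : Set ℕ).indicator a n • φ (x n)‖ₑ := ENNReal.sum_le_tsum s
    _ ≤ _ := tsum_enorm_smul_le hp (one_le_conjExponent p) _ _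
    _ ≤ _ := by
      gcongr
      exact seqNorm_le_weakSeqNorm x hφ

theorem seqNorm_indicator_le {r : ℝ≥0∞} (s : Set ℕ) (a : ℕ → ℂ) :
    seqNorm r (s.indicator a) ≤ seqNorm r a :=
  seqNorm_mono fun n => enorm_le_iff_norm_le.2 (norm_indicator_le_norm_self a n)

/-- Convergence comes from the coefficients: their tails vanish in the `ℓ_{p*}` norm, for `p = 1`
thanks to `c_0`, while the weak norm of `x` need only be finite. -/
theorem summable_smul [CompleteSpace F] (hp : 1 ≤ p) {x : ℕ → F} (hx : weakSeqNorm p x < ∞)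
    {a : ℕ → ℂ} (ha : a ∈ coeffBall p) : Summable fun n => a n • x n := by
  have hlim : Tendsto (fun s : Finset ℕ =>
      seqNorm p.conjExponent (((s : Set ℕ)ᶜ).indicator a)) atTop (𝓝 0) := by
    refine tendsto_seqNorm_of_dominated (one_le_conjExponent p) ((mem_coeffBall_iff hp).1 ha).1
      (fun s n => enorm_le_iff_norm_le.2 (norm_indicator_le_norm_self a n)) fun n => ?_
    refine tendsto_const_nhds.congr' ?_
    filter_upwards [eventually_ge_atTop {n}] with s hs
    rw [indicator_of_notMem]
    simpa using hs (Finset.mem_singleton_self n)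
  have hlim2 : Tendsto (fun s : Finset ℕ =>
      seqNorm p.conjExponent (((s : Set ℕ)ᶜ).indicator a) * weakSeqNorm p x) atTop (𝓝 0) := by
    simpa using ENNReal.Tendsto.mul_const hlim (Or.inr hx.ne)
  rw [summable_iff_vanishing_norm]
  intro ε hε
  obtain ⟨s, hs⟩ := (hlim2.eventually_lt_const (ENNReal.ofReal_pos.2 hε)).exists
  refine ⟨s, fun t ht => ?_⟩
  have h1 : ‖∑ n ∈ t, a n • x n‖ₑ < ENNReal.ofReal ε := by
    refine (enorm_sum_smul_le hp x a t).trans_lt (lt_of_le_of_lt ?_ hs)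
    gcongr 1
    refine seqNorm_mono fun n => enorm_le_iff_norm_le.2 ?_
    refine norm_indicator_le_of_subset (fun n hn => ?_) a n
    simpa using Finset.disjoint_left.1 ht (by simpa using hn)
  rwa [← ofReal_norm, ENNReal.ofReal_lt_ofReal_iff hε] at h1

theorem enorm_le_of_mem_pConv (hp : 1 ≤ p) {x : ℕ → F} {y : F} (hy : y ∈ pConv p x) :
    ‖y‖ₑ ≤ weakSeqNorm p x := by
  obtain ⟨a, ha, h⟩ := hy
  refine le_of_tendsto ((continuous_enorm.tendsto y).comp h) (Eventually.of_forall fun s => ?_)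
  refine (enorm_sum_smul_le hp x a s).trans (mul_le_of_le_one_left' ?_)
  exact (seqNorm_indicator_le _ a).trans ((mem_coeffBall_iff hp).1 ha).2

theorem zero_mem_pConv (hp : 1 ≤ p) (x : ℕ → F) : (0 : F) ∈ pConv p x := by
  have h0 : seqNorm p.conjExponent (fun _ => (0 : ℂ)) ≤ 0 := by
    refine (seqNorm_le_tsum (one_le_conjExponent p) _).trans ?_
    simp
  refine ⟨fun _ => 0, (mem_coeffBall_iff hp).2
    ⟨⟨h0.trans_lt ENNReal.zero_lt_top, fun _ => tendsto_const_nhds⟩, h0.trans zero_le_one⟩, ?_⟩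
  simp [hasSum_zero]

theorem smul_mem_pConv {x : ℕ → F} {y : F} (hy : y ∈ pConv p x) (c : ℂ) :
    c • y ∈ pConv p (fun n => c • x n) := by
  obtain ⟨a, ha, h⟩ := hy
  refine ⟨a, ha, ?_⟩
  simpa only [smul_comm c] using h.const_smul c

/-- `p`-convex hulls are closed under absolutely convex series. -/
theorem hasSum_smul_mem_pConv [CompleteSpace F] (hp : 1 ≤ p) {x : ℕ → F}
    (hx : weakSeqNorm p x < ∞) {c : ℕ → ℂ} (hc : Summable fun k => ‖c k‖)
    (hc1 : ∑' k, ‖c k‖ ≤ 1) {y : ℕ → F} (hy : ∀ k, y k ∈ pConv p x) {w : F}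
    (hw : HasSum (fun k => c k • y k) w) : w ∈ pConv p x := by
  choose a ha hay using hy
  have := holderConjugate_conjExponent hp
  have hb := tsum_mem_coeffBall hp hc hc1 ha
  refine ⟨_, hb, ?_⟩
  have hS := summable_smul hp hx hb
  convert hS.hasSum
  -- The vector double series need not converge absolutely. After applying a functional it does, by
  -- Hölder with a bound `C` independent of `k`, and the two sums may be exchanged.
  refine (SeparatingDual.eq_iff_forall_dual_eq (R := ℂ)).2 fun φ => ?_
  obtain ⟨C, hC⟩ : ∃ C : ℝ, ∀ k, Summable (fun n => ‖a k n * φ (x n)‖) ∧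
      ∑' n, ‖a k n * φ (x n)‖ ≤ C := by
    have hx' : seqNorm p (fun n => φ (x n)) < ∞ := by
      by_cases h0 : φ = 0
      · subst h0
        refine (seqNorm_le_tsum hp _).trans_lt ?_
        simp
      · have hn : (‖φ‖ : ℂ) ≠ 0 := by simpa using h0
        have e : (fun n => φ (x n)) = fun n => (‖φ‖ : ℂ) • (((‖φ‖ : ℂ)⁻¹ • φ) (x n)) := by
          ext n
          simp [hn]
        rw [e, seqNorm_const_smul hp]
        refine ENNReal.mul_lt_top enorm_lt_top ((seqNorm_le_weakSeqNorm x ?_).trans_lt hx)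
        rw [norm_smul, norm_inv]
        simpa using inv_mul_le_one
    refine ⟨(seqNorm p (fun n => φ (x n))).toReal, fun k => ?_⟩
    have h1 := (tsum_enorm_smul_le hp (one_le_conjExponent p) (a k) (fun n => φ (x n))).trans
      (mul_le_of_le_one_left' ((mem_coeffBall_iff hp).1 (ha k)).2)
    have h2 : Summable fun n => ‖a k n * φ (x n)‖ := by
      have := ENNReal.summable_toReal (h1.trans_lt hx').ne
      simpa using this
    refine ⟨h2, ?_⟩
    have h3 : ∑' n, ‖a k n * φ (x n)‖ = (∑' n, ‖a k n • φ (x n)‖ₑ).toReal := by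
      rw [ENNReal.tsum_toReal_eq fun _ => enorm_ne_top]
      simp
    rw [h3]
    exact ENNReal.toReal_mono hx'.ne h1
  have hsum : Summable fun kn : ℕ × ℕ => c kn.1 * (a kn.1 kn.2 * φ (x kn.2)) := by
    refine Summable.of_norm ?_
    rw [summable_prod_of_nonneg fun _ => norm_nonneg _]
    simp only [norm_mul (c _)]
    refine ⟨fun k => (hC k).1.mul_left _, ?_⟩
    refine Summable.of_nonneg_of_le (fun k => tsum_nonneg fun n => by positivity)
      (fun k => ?_) (hc.mul_right C)
    rw [tsum_mul_left]
    exact mul_le_mul_of_nonneg_left (hC k).2 (norm_nonneg _)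
  have e1 : φ w = ∑' k, ∑' n, c k * (a k n * φ (x n)) := by
    rw [← (hw.mapL φ).tsum_eq]
    refine tsum_congr fun k => ?_
    rw [tsum_mul_left, map_smul, smul_eq_mul, ← ((hay k).mapL φ).tsum_eq]
    simp
  have e2 : φ (∑' n, (∑' k, c k * a k n) • x n) = ∑' n, ∑' k, c k * (a k n * φ (x n)) := by
    rw [← (hS.hasSum.mapL φ).tsum_eq]
    refine tsum_congr fun n => ?_
    rw [map_smul, smul_eq_mul, ← tsum_mul_right]
    simp only [mul_assoc]
  rw [e1, e2]
  exact Summable.tsum_comm (f := fun n k => c k * (a k n * φ (x n)))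
    ((Equiv.prodComm ℕ ℕ).summable_iff.2 hsum)

theorem hasSum_of_two_le_eq_zero {G : Type*} [AddCommMonoid G] [TopologicalSpace G] {f : ℕ → G}
    (h : ∀ k, 2 ≤ k → f k = 0) : HasSum f (f 0 + f 1) := by
  have := hasSum_sum_of_ne_finset_zero (f := f) (s := Finset.range 2) (L := .unconditional ℕ)
    fun k hk => h k (by simpa [Nat.succ_le_iff] using hk)
  simpa [Finset.sum_range_succ] using this

/-- Both properties are cases of `hasSum_smul_mem_pConv` with at most two nonzero coefficients. -/
theorem balanced_convex_pConv [CompleteSpace F] (hp : 1 ≤ p) {x : ℕ → F}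
    (hx : weakSeqNorm p x < ∞) :
    Balanced ℂ (pConv p x) ∧ Convex ℝ (pConv p x) := by
  have key : ∀ (a b : ℂ), ‖a‖ + ‖b‖ ≤ 1 → ∀ y ∈ pConv p x, ∀ z ∈ pConv p x,
      a • y + b • z ∈ pConv p x := by
    intro a b hab y hy z hz
    set c : ℕ → ℂ := fun k => if k = 0 then a else if k = 1 then b else 0 with hc
    have hc0 : ∀ k, 2 ≤ k → c k = 0 := fun k hk => by
      simp [hc, show k ≠ 0 by omega, show k ≠ 1 by omega]
    have hcs := hasSum_of_two_le_eq_zero (f := fun k => ‖c k‖) fun k hk => by simp [hc0 k hk]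
    refine hasSum_smul_mem_pConv hp hx (c := c) (y := fun k => if k = 0 then y else z)
      hcs.summable ?_ (fun k => by split_ifs <;> assumption) ?_
    · rw [hcs.tsum_eq]
      simpa [hc] using hab
    · have := hasSum_of_two_le_eq_zero (f := fun k => c k • if k = 0 then y else z)
        fun k hk => by rw [hc0 k hk, zero_smul]
      simpa [hc] using this
  refine ⟨balanced_iff_smul_mem.2 fun {a} ha y hy => ?_, fun y hy z hz a b ha hb hab => ?_⟩
  · simpa using key a 0 (by simpa using ha) y hy y hy
  · have := key a b (by simp [abs_of_nonneg ha, abs_of_nonneg hb, hab]) y hy z hz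
    simpa using this

end Weak

/-! ### Admissible sequences -/

section Admissible

variable {F : Type*} [NormedAddCommGroup F] [NormedSpace ℂ F] {p : ℝ≥0∞} {i : Kind}

theorem seqNorm_top_lt_top_of_tendsto {X : Type*} [NormedAddCommGroup X] {x : ℕ → X}
    (h : Tendsto x atTop (𝓝 0)) : seqNorm ∞ x < ∞ := by
  obtain ⟨C, hC⟩ := (Metric.isBounded_range_of_tendsto x h).exists_norm_le
  rw [seqNorm_top]
  refine (iSup_le fun n => ?_).trans_lt (ENNReal.ofReal_lt_top (r := C))
  rw [← ofReal_norm]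
  exact ENNReal.ofReal_le_ofReal (hC _ ⟨n, rfl⟩)

/-- Uniform boundedness principle for the `x n` viewed as functionals on the dual, which is always
complete. -/
theorem seqNorm_top_lt_top_of_weakly_null {x : ℕ → F}
    (h : ∀ φ : StrongDual ℂ F, Tendsto (fun n => φ (x n)) atTop (𝓝 0)) : seqNorm ∞ x < ∞ := by
  obtain ⟨C, hC⟩ := banach_steinhaus
    (g := fun n => NormedSpace.inclusionInDoubleDualLi (E := F) ℂ (x n)) fun φ => by
      obtain ⟨C, hC⟩ := (Metric.isBounded_range_of_tendsto _ (h φ)).exists_norm_le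
      exact ⟨C, fun n => hC _ ⟨n, rfl⟩⟩
  rw [seqNorm_top]
  refine (iSup_le fun n => ?_).trans_lt (ENNReal.ofReal_lt_top (r := C))
  rw [← ofReal_norm]
  refine ENNReal.ofReal_le_ofReal ?_
  simpa only [LinearIsometry.norm_map] using hC n

theorem admissible_strong_iff {x : ℕ → F} : Admissible .strong p x ↔ IsLpNull p x := by
  by_cases h : p = ∞
  · subst h
    simp only [Admissible, IsLpNull, if_true, forall_const]
    exact ⟨fun h => ⟨seqNorm_top_lt_top_of_tendsto h, h⟩, fun h => h.2⟩
  · simp [Admissible, IsLpNull, h]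

theorem admissible_weak_iff {x : ℕ → F} : Admissible .weak p x ↔
    weakSeqNorm p x < ∞ ∧
      (p = ∞ → ∀ φ : StrongDual ℂ F, Tendsto (fun n => φ (x n)) atTop (𝓝 0)) := by
  by_cases h : p = ∞
  · subst h
    simp only [Admissible, if_true, forall_const, weakSeqNorm_top]
    exact ⟨fun h => ⟨seqNorm_top_lt_top_of_weakly_null h, h⟩, fun h => h.2⟩
  · simp [Admissible, h]

/-- For `p = ∞` vanishing tails in the supremum norm mean norm convergence to zero, so the tail
condition describes all `p` at once. -/
theorem admissible_uncond_iff {x : ℕ → F} : Admissible .uncond p x ↔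
    weakSeqNorm p x < ∞ ∧ Tendsto (fun m => weakSeqNorm p (fun n => x (n + m))) atTop (𝓝 0) := by
  by_cases h : p = ∞
  · subst h
    simp only [Admissible, if_true, weakSeqNorm_top]
    refine ⟨fun h => ⟨seqNorm_top_lt_top_of_tendsto h, ?_⟩, fun h => ?_⟩
    · rw [ENNReal.tendsto_nhds_zero]
      intro ε hε
      have h0 := (continuous_enorm.tendsto (0 : F)).comp h
      rw [enorm_zero, ENNReal.tendsto_nhds_zero] at h0
      obtain ⟨N, hN⟩ := eventually_atTop.1 (h0 ε hε)
      filter_upwards [eventually_ge_atTop N] with m hm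
      rw [seqNorm_top]
      exact iSup_le fun n => hN _ (by omega)
    · rw [tendsto_zero_iff_enorm_tendsto_zero]
      refine tendsto_of_tendsto_of_tendsto_of_le_of_le tendsto_const_nhds h.2 (fun _ => zero_le)
        fun m => ?_
      simpa using enorm_le_seqNorm le_top (fun n => x (n + m)) 0
  · simp [Admissible, h]

theorem kindNorm_strong (x : ℕ → F) : kindNorm .strong p x = seqNorm p x := by
  by_cases h : p = ∞ <;> simp [kindNorm, h]

theorem kindNorm_weak (x : ℕ → F) : kindNorm .weak p x = weakSeqNorm p x := by
  by_cases h : p = ∞ <;> simp [kindNorm, h, weakSeqNorm_top]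

theorem kindNorm_uncond (x : ℕ → F) : kindNorm .uncond p x = weakSeqNorm p x := by
  by_cases h : p = ∞ <;> simp [kindNorm, h, weakSeqNorm_top]

theorem weakSeqNorm_le_kindNorm (i : Kind) (x : ℕ → F) : weakSeqNorm p x ≤ kindNorm i p x := by
  cases i
  · rw [kindNorm_strong]; exact weakSeqNorm_le_seqNorm x
  · rw [kindNorm_weak]
  · rw [kindNorm_uncond]

theorem Admissible.kindNorm_lt_top {x : ℕ → F} (h : Admissible i p x) : kindNorm i p x < ∞ := by
  cases i
  · rw [kindNorm_strong]; exact (admissible_strong_iff.1 h).1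
  · rw [kindNorm_weak]; exact (admissible_weak_iff.1 h).1
  · rw [kindNorm_uncond]; exact (admissible_uncond_iff.1 h).1

theorem Admissible.weakSeqNorm_lt_top {x : ℕ → F} (h : Admissible i p x) : weakSeqNorm p x < ∞ :=
  (weakSeqNorm_le_kindNorm i x).trans_lt h.kindNorm_lt_top

theorem Admissible.const_smul (hp : 1 ≤ p) {x : ℕ → F} (h : Admissible i p x) (c : ℂ) :
    Admissible i p (fun n => c • x n) := by
  cases i
  · exact admissible_strong_iff.2 ((admissible_strong_iff.1 h).const_smul hp c)
  · rw [admissible_weak_iff] at h ⊢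
    refine ⟨(weakSeqNorm_const_smul_le hp c x).trans_lt (ENNReal.mul_lt_top enorm_lt_top h.1),
      fun hp' φ => ?_⟩
    simpa using (h.2 hp' φ).const_mul c
  · rw [admissible_uncond_iff] at h ⊢
    refine ⟨(weakSeqNorm_const_smul_le hp c x).trans_lt (ENNReal.mul_lt_top enorm_lt_top h.1), ?_⟩
    refine tendsto_of_tendsto_of_tendsto_of_le_of_le tendsto_const_nhds ?_ (fun _ => zero_le)
      fun m => weakSeqNorm_const_smul_le hp c _
    simpa using ENNReal.Tendsto.const_mul h.2 (Or.inr enorm_ne_top)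

theorem kindNorm_const_smul_le (hp : 1 ≤ p) (c : ℂ) (x : ℕ → F) :
    kindNorm i p (fun n => c • x n) ≤ ‖c‖ₑ * kindNorm i p x := by
  cases i
  · simp only [kindNorm_strong, seqNorm_const_smul hp, le_refl]
  · simpa only [kindNorm_weak] using weakSeqNorm_const_smul_le hp c x
  · simpa only [kindNorm_uncond] using weakSeqNorm_const_smul_le hp c x

theorem kindNorm_zero (hp : 1 ≤ p) : kindNorm i p (fun _ => (0 : F)) = 0 := by
  simpa using kindNorm_const_smul_le (i := i) hp 0 (fun _ => (0 : F))

theorem admissible_zero (hp : 1 ≤ p) : Admissible i p (fun _ => (0 : F)) := by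
  have hw : weakSeqNorm p (fun _ => (0 : F)) = 0 := by
    rw [← kindNorm_weak, kindNorm_zero hp]
  cases i
  · refine admissible_strong_iff.2 ⟨?_, fun _ => tendsto_const_nhds⟩
    rw [← kindNorm_strong, kindNorm_zero hp]
    exact ENNReal.zero_lt_top
  · rw [admissible_weak_iff, hw]
    exact ⟨ENNReal.zero_lt_top, fun _ φ => by simp⟩
  · rw [admissible_uncond_iff, hw]
    exact ⟨ENNReal.zero_lt_top, tendsto_const_nhds⟩

/-- The tail of a concatenation consists of tails of the single sequences. -/
theorem weakSeqNorm_concat_tail_le (hp : 1 ≤ p) {x : ℕ → ℕ → F}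
    (hx : ∀ k, weakSeqNorm p (x k) < ∞) (m : ℕ) :
    weakSeqNorm p (fun n => concat x (n + m)) ≤
      seqNorm p (fun k => (weakSeqNorm p
        (fun n => if m ≤ Nat.pair k n then x k n else 0)).toReal) := by
  -- Finiteness ensures that `toReal` in the statement loses nothing.
  have hlt : ∀ k, weakSeqNorm p (fun n => if m ≤ Nat.pair k n then x k n else 0) < ∞ := fun k =>
    (weakSeqNorm_mono fun n => ⟨if m ≤ Nat.pair k n then 1 else 0, by split_ifs <;> simp,
      by split_ifs <;> simp⟩).trans_lt (hx k)
  refine weakSeqNorm_le_iff.2 fun φ hφ => ?_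
  refine le_trans ?_ (seqNorm_concat_le hp
    (z := fun k n => φ (if m ≤ Nat.pair k n then x k n else 0)) fun k => ?_)
  · set y : ℕ → ℂ := concat fun k n => φ (if m ≤ Nat.pair k n then x k n else 0) with hy
    have e : (fun n => φ (concat x (n + m))) = fun n => y (n + m) := by
      ext n
      simp [hy, concat]
    rw [e]
    by_cases h : p = ∞
    · subst h
      simp only [seqNorm_top]
      exact iSup_le fun n => le_iSup (fun n => ‖y n‖ₑ) (n + m)
    · rw [seqNorm_of_ne_top h, seqNorm_of_ne_top h]
      refine ENNReal.rpow_le_rpow ?_ (by positivity)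
      exact ENNReal.tsum_comp_le_tsum_of_injective (add_left_injective m)
        (fun n => ‖y n‖ₑ ^ p.toReal)
  · refine (seqNorm_le_weakSeqNorm _ hφ).trans ?_
    rw [← ofReal_norm, Real.norm_of_nonneg ENNReal.toReal_nonneg, ENNReal.ofReal_toReal (hlt k).ne]

/-- The concatenation of admissible sequences. -/
theorem admissible_concat (hp : 1 ≤ p) {x : ℕ → ℕ → F} (hx : ∀ k, Admissible i p (x k))
    {μ : ℕ → ℝ} (hμ : IsLpNull p μ) (hxμ : ∀ k, kindNorm i p (x k) ≤ ‖μ k‖ₑ) :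
    Admissible i p (concat x) ∧ kindNorm i p (concat x) ≤ seqNorm p μ := by
  have hw : weakSeqNorm p (concat x) ≤ seqNorm p μ := weakSeqNorm_le_iff.2 fun φ hφ =>
    seqNorm_concat_le hp (z := fun k n => φ (x k n)) fun k =>
      ((seqNorm_le_weakSeqNorm _ hφ).trans (weakSeqNorm_le_kindNorm i _)).trans (hxμ k)
  cases i
  · simp only [kindNorm_strong, admissible_strong_iff] at *
    exact ⟨hμ.concat hp hx hxμ, seqNorm_concat_le hp hxμ⟩
  · simp only [kindNorm_weak] at *
    refine ⟨admissible_weak_iff.2 ⟨hw.trans_lt hμ.1, fun hp' φ => ?_⟩, hw⟩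
    have key : ∀ φ : StrongDual ℂ F, ‖φ‖ ≤ 1 →
        Tendsto (fun n => φ (concat x n)) atTop (𝓝 0) := fun φ hφ => by
      refine (hμ.concat hp (z := fun k n => φ (x k n)) (fun k => ?_) fun k =>
        (seqNorm_le_weakSeqNorm _ hφ).trans (hxμ k)).2 hp'
      exact ⟨(seqNorm_le_weakSeqNorm _ hφ).trans_lt (hx k).weakSeqNorm_lt_top,
        fun _ => (admissible_weak_iff.1 (hx k)).2 hp' φ⟩
    by_cases h0 : φ = 0
    · simp [h0]
    have hn : (‖φ‖ : ℂ) ≠ 0 := by simpa using h0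
    have := (key ((‖φ‖ : ℂ)⁻¹ • φ) (by
      rw [norm_smul, norm_inv]
      simpa using inv_mul_le_one)).const_mul (‖φ‖ : ℂ)
    simpa [hn] using this
  · simp only [kindNorm_uncond] at *
    refine ⟨admissible_uncond_iff.2 ⟨hw.trans_lt hμ.1, ?_⟩, hw⟩
    refine tendsto_of_tendsto_of_tendsto_of_le_of_le tendsto_const_nhds ?_ (fun _ => zero_le)
      fun m => weakSeqNorm_concat_tail_le hp (fun k => (hx k).weakSeqNorm_lt_top) m
    -- The weak norms of the truncated rows are dominated by `μ`, and for each fixed row they tend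
    -- to zero as `m` grows.
    refine tendsto_seqNorm_of_dominated hp hμ (fun m k => ?_) fun k => ?_
    · rw [← ofReal_norm, Real.norm_of_nonneg ENNReal.toReal_nonneg]
      refine ENNReal.ofReal_toReal_le.trans (le_trans ?_ (hxμ k))
      exact weakSeqNorm_mono fun n => ⟨if m ≤ Nat.pair k n then 1 else 0,
        by split_ifs <;> simp, by split_ifs <;> simp⟩
    · rw [← ENNReal.toReal_zero]
      refine (ENNReal.tendsto_toReal ENNReal.zero_ne_top).comp ?_
      rw [ENNReal.tendsto_nhds_zero]
      intro ε hε
      have ht := (admissible_uncond_iff.1 (hx k)).2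
      rw [ENNReal.tendsto_nhds_zero] at ht
      obtain ⟨N, hN⟩ := (ht ε hε).exists
      -- As `Nat.pair k n < (max k n + 1) ^ 2`, such an `m` cuts off every entry of row `k` with `n
      -- < N`, so only a part of its `N`-th tail survives.
      filter_upwards [eventually_ge_atTop ((max k N + 1) ^ 2)] with m hm
      refine le_trans (weakSeqNorm_le_iff.2 fun φ hφ => ?_) hN
      have hsmall : ∀ n < N, (if m ≤ Nat.pair k n then x k n else 0) = 0 := fun n hn => by
        rw [if_neg]
        have h1 := Nat.pair_lt_max_add_one_sq k n
        have h2 : (max k n + 1) ^ 2 ≤ (max k N + 1) ^ 2 := by gcongr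
        omega
      have hle : ∀ n, ‖φ (if m ≤ Nat.pair k (n + N) then x k (n + N) else 0)‖ₑ
          ≤ ‖φ (x k (n + N))‖ₑ := fun n => by
        split_ifs
        · exact le_rfl
        · simp
      refine le_trans ?_ (seqNorm_le_weakSeqNorm _ hφ)
      refine le_trans ?_ (seqNorm_mono hle)
      set y : ℕ → ℂ := fun n => φ (if m ≤ Nat.pair k n then x k n else 0) with hy
      have hy0 : ∀ n < N, y n = 0 := fun n hn => by rw [hy]; simp only [hsmall n hn, map_zero]
      change seqNorm p y ≤ seqNorm p fun n => y (n + N)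
      by_cases h : p = ∞
      · subst h
        simp only [seqNorm_top]
        refine iSup_le fun n => ?_
        by_cases hn : n < N
        · simp [hy0 n hn]
        · have := le_iSup (fun n => ‖y (n + N)‖ₑ) (n - N)
          simpa [Nat.sub_add_cancel (not_lt.1 hn)] using this
      · have hpos := toReal_pos_of_one_le hp h
        rw [seqNorm_of_ne_top h, seqNorm_of_ne_top h]
        refine ENNReal.rpow_le_rpow (le_of_eq ?_) (by positivity)
        refine ((add_left_injective N).tsum_eq (f := fun n => ‖y n‖ₑ ^ p.toReal)
          fun n hn => ?_).symm
        by_contra hN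
        have hnN : n < N := not_le.1 fun h => hN ⟨n - N, Nat.sub_add_cancel h⟩
        simp [hy0 n hnN, hpos] at hn

/-- Series of elements of `p`-convex hulls. -/
theorem exists_hasSum_mem_pConv_concat [CompleteSpace F] (hp : 1 ≤ p) {x : ℕ → ℕ → F}
    (hx : weakSeqNorm p (concat x) < ∞) {c : ℕ → ℂ} (hc : c ∈ coeffBall p) {y : ℕ → F}
    (hy : ∀ k, y k ∈ pConv p (x k)) :
    ∃ w ∈ pConv p (concat x), HasSum (fun k => c k • y k) w := by
  choose a ha hay using hy
  have hb := concat_mem_coeffBall hp hc ha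
  have hs := (summable_smul hp hx hb).hasSum
  refine ⟨_, ⟨_, hb, hs⟩, ?_⟩
  have hs' := Nat.pairEquiv.hasSum_iff.2 hs
  refine HasSum.prod_fiberwise hs' fun k => ?_
  simpa [concat, Function.comp_def, mul_smul] using (hay k).const_smul (c k)

end Admissible

/-! ### The operator ideals are Banach spaces -/

section Measure

variable {F : Type*} [NormedAddCommGroup F] [NormedSpace ℂ F] {p : ℝ≥0∞} {i : Kind} {K : Set F}

theorem RelCompact.mono {K' : Set F} (h : RelCompact i p K) (hK : K' ⊆ K) : RelCompact i p K' := by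
  obtain ⟨x, hx, hKx⟩ := h
  exact ⟨x, hx, hK.trans hKx⟩

/-- Excludes the case in which `toReal` would turn an infinite infimum into `0`. -/
theorem RelCompact.iInf_lt_top (h : RelCompact i p K) :
    ⨅ (x : ℕ → F) (_ : Admissible i p x ∧ K ⊆ pConv p x), kindNorm i p x < ∞ := by
  obtain ⟨x, hx⟩ := h
  exact (iInf₂_le x hx).trans_lt hx.1.kindNorm_lt_top

theorem RelCompact.exists_kindNorm_lt (h : RelCompact i p K) {r : ℝ} (hr : measureSize i p K < r) :
    ∃ x : ℕ → F, Admissible i p x ∧ K ⊆ pConv p x ∧ kindNorm i p x < ENNReal.ofReal r := by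
  have h1 := (ENNReal.lt_ofReal_iff_toReal_lt h.iInf_lt_top.ne).2 hr
  simp only [iInf_lt_iff] at h1
  obtain ⟨x, ⟨hx, hK⟩, hlt⟩ := h1
  exact ⟨x, hx, hK, hlt⟩

theorem measureSize_le {x : ℕ → F} (hx : Admissible i p x) (hK : K ⊆ pConv p x) :
    measureSize i p K ≤ (kindNorm i p x).toReal :=
  ENNReal.toReal_mono hx.kindNorm_lt_top.ne (iInf₂_le x ⟨hx, hK⟩)

theorem measureSize_mono {K' : Set F} (h : RelCompact i p K) (hK : K' ⊆ K) :
    measureSize i p K' ≤ measureSize i p K :=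
  ENNReal.toReal_mono h.iInf_lt_top.ne
    (iInf_mono fun _ => iInf_mono' fun hx => ⟨⟨hx.1, hK.trans hx.2⟩, le_rfl⟩)

theorem measureSize_nonneg : 0 ≤ measureSize i p K := ENNReal.toReal_nonneg

theorem norm_le_measureSize (hp : 1 ≤ p) (h : RelCompact i p K) {y : F} (hy : y ∈ K) :
    ‖y‖ ≤ measureSize i p K := by
  rw [measureSize, ← ENNReal.ofReal_le_iff_le_toReal h.iInf_lt_top.ne]
  refine le_iInf₂ fun x hx => ?_
  rw [ofReal_norm]
  exact (enorm_le_of_mem_pConv hp (hx.2 hy)).trans (weakSeqNorm_le_kindNorm i x)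

/-- The common source of the triangle inequality and of completeness: elements `∑ c_k z_k` lie in
the hull of the concatenation, at the cost `‖μ‖_p`. -/
theorem measureSize_le_of_series [CompleteSpace F] (hp : 1 ≤ p) {x : ℕ → ℕ → F}
    (hx : ∀ k, Admissible i p (x k)) {μ : ℕ → ℝ} (hμ : IsLpNull p μ)
    (hxμ : ∀ k, kindNorm i p (x k) ≤ ‖μ k‖ₑ) {c : ℕ → ℂ} (hc : c ∈ coeffBall p)
    (hK : ∀ y ∈ K, ∃ z : ℕ → F, (∀ k, z k ∈ pConv p (x k)) ∧
      Tendsto (fun n => ∑ k ∈ Finset.range n, c k • z k) atTop (𝓝 y)) :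
    RelCompact i p K ∧ measureSize i p K ≤ (seqNorm p μ).toReal := by
  obtain ⟨h1, h2⟩ := admissible_concat hp hx hμ hxμ
  have hsub : K ⊆ pConv p (concat x) := fun y hy => by
    obtain ⟨z, hz, hlim⟩ := hK y hy
    obtain ⟨w, hw, hsum⟩ := exists_hasSum_mem_pConv_concat hp h1.weakSeqNorm_lt_top hc hz
    rwa [tendsto_nhds_unique hlim hsum.tendsto_sum_nat]
  exact ⟨⟨_, h1, hsub⟩, (measureSize_le h1 hsub).trans (ENNReal.toReal_mono hμ.1.ne h2)⟩

/-- The `ℓ_r`-normalized sequence `(w^{1/r}, (1-w)^{1/r}, 0, 0, …)`. -/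
def twoTerm (w : ℝ) (r : ℝ≥0∞) (k : ℕ) : ℝ :=
  if k = 0 then w ^ r.toReal⁻¹ else if k = 1 then (1 - w) ^ r.toReal⁻¹ else 0

theorem twoTerm_of_two_le (w : ℝ) (r : ℝ≥0∞) {k : ℕ} (hk : 2 ≤ k) : twoTerm w r k = 0 := by
  simp [twoTerm, show k ≠ 0 by omega, show k ≠ 1 by omega]

theorem seqNorm_twoTerm_le {w : ℝ} (h0 : 0 < w) (h1 : w < 1) {r : ℝ≥0∞} (hr : 1 ≤ r) :
    seqNorm r (twoTerm w r) ≤ 1 := by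
  by_cases h : r = ∞
  · subst h
    rw [seqNorm_top]
    refine iSup_le fun k => ?_
    rw [← enorm_one (G := ℝ), enorm_le_iff_norm_le]
    -- Here `∞.toReal⁻¹ = 0`, so both nonzero entries are `1`.
    simp only [twoTerm]
    split_ifs <;> simp
  · have hpos := toReal_pos_of_one_le hr h
    have key : ∀ u : ℝ, 0 < u → ‖u ^ r.toReal⁻¹‖ₑ ^ r.toReal = ENNReal.ofReal u := fun u hu => by
      rw [← ofReal_norm, Real.norm_of_nonneg (by positivity),
        ENNReal.ofReal_rpow_of_nonneg (by positivity) hpos.le, ← Real.rpow_mul hu.le,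
        inv_mul_cancel₀ hpos.ne', Real.rpow_one]
    rw [seqNorm_of_ne_top h,
      (hasSum_of_two_le_eq_zero (f := fun k => ‖twoTerm w r k‖ₑ ^ r.toReal) fun k hk => by
        rw [twoTerm_of_two_le w r hk, enorm_zero, ENNReal.zero_rpow_of_pos hpos]).tsum_eq]
    simp only [twoTerm, if_true, one_ne_zero, if_false]
    rw [key w h0, key (1 - w) (by linarith), ← ENNReal.ofReal_add h0.le (by linarith)]
    simp

theorem isLpNull_twoTerm {w : ℝ} (h0 : 0 < w) (h1 : w < 1) {r : ℝ≥0∞} (hr : 1 ≤ r) :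
    IsLpNull r (twoTerm w r) := by
  refine ⟨(seqNorm_twoTerm_le h0 h1 hr).trans_lt ENNReal.one_lt_top, fun _ => ?_⟩
  refine tendsto_const_nhds.congr' ?_
  filter_upwards [eventually_ge_atTop 2] with k hk
  rw [twoTerm_of_two_le w r hk]

/-- Also valid for `p = 1` and `p = ∞`, because `∞.toReal⁻¹ = 0`. -/
theorem inv_toReal_add_inv_toReal_conjExponent (hp : 1 ≤ p) :
    p.toReal⁻¹ + p.conjExponent.toReal⁻¹ = 1 := by
  have := ENNReal.HolderConjugate.conjExponent hp
  have h := ENNReal.HolderConjugate.inv_add_inv_eq_one p p.conjExponent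
  have h' := congrArg ENNReal.toReal h
  rwa [ENNReal.toReal_add (ENNReal.inv_ne_top.2 (zero_lt_one.trans_le hp).ne')
    (ENNReal.inv_ne_top.2 (zero_lt_one.trans_le (one_le_conjExponent p)).ne'),
    ENNReal.toReal_inv, ENNReal.toReal_inv, ENNReal.toReal_one] at h'

theorem ofReal_comp_mem_coeffBall (hp : 1 ≤ p) {d : ℕ → ℝ} (h : IsLpNull p.conjExponent d)
    (h1 : seqNorm p.conjExponent d ≤ 1) : (fun k => (d k : ℂ)) ∈ coeffBall p := by
  have e : seqNorm p.conjExponent (fun k => (d k : ℂ)) ≤ seqNorm p.conjExponent d :=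
    seqNorm_mono fun k => enorm_le_iff_norm_le.2 (by simp)
  refine (mem_coeffBall_iff hp).2 ⟨⟨e.trans_lt h.1, fun ht => ?_⟩, e.trans h1⟩
  simpa [Function.comp_def] using (Complex.continuous_ofReal.tendsto 0).comp (h.2 ht)

/-- Subadditivity of the measure of a set. -/
theorem measureSize_add_le [CompleteSpace F] (hp : 1 ≤ p) {K₁ K₂ : Set F}
    (h₁ : RelCompact i p K₁) (h₂ : RelCompact i p K₂)
    (hK : ∀ y ∈ K, ∃ y₁ ∈ K₁, ∃ y₂ ∈ K₂, y₁ + y₂ = y) :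
    RelCompact i p K ∧ measureSize i p K ≤ measureSize i p K₁ + measureSize i p K₂ := by
  have main : ∀ s t : ℝ, measureSize i p K₁ < s → measureSize i p K₂ < t →
      RelCompact i p K ∧ measureSize i p K ≤ s + t := by
    intro s t hs ht
    have hs0 := measureSize_nonneg.trans_lt hs
    have ht0 := measureSize_nonneg.trans_lt ht
    obtain ⟨x₁, hx₁, hKx₁, hlt₁⟩ := h₁.exists_kindNorm_lt hs
    obtain ⟨x₂, hx₂, hKx₂, hlt₂⟩ := h₂.exists_kindNorm_lt ht
    -- With `q = p*`, the sequence `x₁` divided by `w^(1/q)` has norm at most `s w^(-1/q) = (s+t)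
    -- w^(1/p)`; likewise `x₂` with `1 - w`. The costs then have `ℓ_p` norm at most `s + t`, and the
    -- coefficients `w^(1/q)`, `(1-w)^(1/q)` that undo the division lie in the `ℓ_q` ball.
    set w := s / (s + t) with hw
    have hw0 : 0 < w := by positivity
    have hw1 : w < 1 := (div_lt_one (by positivity)).2 (by linarith)
    have hsw : s = (s + t) * w := by rw [hw]; field_simp
    have htw : t = (s + t) * (1 - w) := by rw [hw]; field_simp; ring
    set q := p.conjExponent
    have hpq := inv_toReal_add_inv_toReal_conjExponent hp
    have hμ := (isLpNull_twoTerm hw0 hw1 hp)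
    have hc := ofReal_comp_mem_coeffBall hp (isLpNull_twoTerm hw0 hw1 (one_le_conjExponent p))
      (seqNorm_twoTerm_le hw0 hw1 (one_le_conjExponent p))
    have hμs : seqNorm p (fun k => ((s + t : ℝ) : ℂ) • (twoTerm w p k : ℂ)) ≤
        ENNReal.ofReal (s + t) := by
      rw [seqNorm_const_smul hp]
      calc _ ≤ ENNReal.ofReal (s + t) * 1 := by
            gcongr
            · rw [← ofReal_norm, Complex.norm_real, Real.norm_of_nonneg (by positivity)]
            · exact (seqNorm_mono fun k => enorm_le_iff_norm_le.2 (by simp)).trans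
                (seqNorm_twoTerm_le hw0 hw1 hp)
        _ = _ := mul_one _
    have hμs' : seqNorm p (fun k => (s + t) * twoTerm w p k) ≤ ENNReal.ofReal (s + t) :=
      (seqNorm_mono fun k => enorm_le_iff_norm_le.2
        (by rw [norm_smul, norm_mul, Complex.norm_real, Complex.norm_real])).trans hμs
    have scale : ∀ u : ℝ, 0 < u → ∀ x : ℕ → F, kindNorm i p x < ENNReal.ofReal ((s + t) * u) →
        kindNorm i p (fun n => ((u ^ q.toReal⁻¹ : ℝ) : ℂ)⁻¹ • x n) ≤
          ‖(s + t) * u ^ p.toReal⁻¹‖ₑ := by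
      intro u hu x hx
      refine (kindNorm_const_smul_le hp _ _).trans ((mul_le_mul_right hx.le _).trans ?_)
      rw [← ofReal_norm, ← ofReal_norm, ← ENNReal.ofReal_mul (norm_nonneg _)]
      refine ENNReal.ofReal_le_ofReal (le_of_eq ?_)
      rw [norm_inv, Complex.norm_real, Real.norm_of_nonneg (by positivity),
        Real.norm_of_nonneg (by positivity)]
      have e : u = u ^ p.toReal⁻¹ * u ^ q.toReal⁻¹ := by
        rw [← Real.rpow_add hu, hpq, Real.rpow_one]
      have hne : u ^ q.toReal⁻¹ ≠ 0 := by positivity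
      calc (u ^ q.toReal⁻¹)⁻¹ * ((s + t) * u) =
          (u ^ q.toReal⁻¹)⁻¹ * ((s + t) * (u ^ p.toReal⁻¹ * u ^ q.toReal⁻¹)) := by rw [← e]
        _ = _ := by field_simp
    have hcancel : ∀ u : ℝ, 0 < u → ((u ^ q.toReal⁻¹ : ℝ) : ℂ) ≠ 0 := fun u hu =>
      Complex.ofReal_ne_zero.2 (by positivity)
    have res := measureSize_le_of_series (i := i) (K := K) hp
      (x := fun k => if k = 0 then fun n => ((w ^ q.toReal⁻¹ : ℝ) : ℂ)⁻¹ • x₁ n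
        else if k = 1 then fun n => (((1 - w) ^ q.toReal⁻¹ : ℝ) : ℂ)⁻¹ • x₂ n else fun _ => 0)
      (μ := fun k => (s + t) * twoTerm w p k) (fun k => ?_)
      ⟨hμs'.trans_lt ENNReal.ofReal_lt_top, fun ht => by simpa using (hμ.2 ht).const_mul (s + t)⟩
      (fun k => ?_) hc fun y hy => ?_
    · exact ⟨res.1, res.2.trans (ENNReal.toReal_le_of_le_ofReal (by positivity) hμs')⟩
    · split_ifs
      · exact hx₁.const_smul hp _
      · exact hx₂.const_smul hp _
      · exact admissible_zero hp
    · simp only [twoTerm]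
      split_ifs
      · exact scale w hw0 x₁ (hsw ▸ hlt₁)
      · exact scale (1 - w) (by linarith) x₂ (htw ▸ hlt₂)
      · simp [kindNorm_zero hp]
    · obtain ⟨y₁, hy₁, y₂, hy₂, rfl⟩ := hK y hy
      refine ⟨fun k => if k = 0 then ((w ^ q.toReal⁻¹ : ℝ) : ℂ)⁻¹ • y₁
        else if k = 1 then (((1 - w) ^ q.toReal⁻¹ : ℝ) : ℂ)⁻¹ • y₂ else 0, fun k => ?_, ?_⟩
      · dsimp only
        split_ifs
        · exact smul_mem_pConv (hKx₁ hy₁) _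
        · exact smul_mem_pConv (hKx₂ hy₂) _
        · exact zero_mem_pConv hp _
      · refine HasSum.tendsto_sum_nat ?_
        have := hasSum_of_two_le_eq_zero (f := fun k => (twoTerm w q k : ℂ) •
          (if k = 0 then ((w ^ q.toReal⁻¹ : ℝ) : ℂ)⁻¹ • y₁
            else if k = 1 then (((1 - w) ^ q.toReal⁻¹ : ℝ) : ℂ)⁻¹ • y₂ else 0))
          fun k hk => by rw [twoTerm_of_two_le w q hk, Complex.ofReal_zero, zero_smul]
        convert this using 1
        simp only [twoTerm, if_true, one_ne_zero, if_false]
        rw [smul_inv_smul₀ (hcancel w hw0), smul_inv_smul₀ (hcancel (1 - w) (by linarith))]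
  refine ⟨(main _ _ (lt_add_one _) (lt_add_one _)).1, le_of_forall_pos_le_add fun ε hε => ?_⟩
  have := (main (measureSize i p K₁ + ε / 2) (measureSize i p K₂ + ε / 2) (by linarith)
    (by linarith)).2
  linarith

theorem measureSize_smul_le (hp : 1 ≤ p) (h : RelCompact i p K) (c : ℂ) {K' : Set F}
    (hK : ∀ y ∈ K', ∃ z ∈ K, y = c • z) :
    RelCompact i p K' ∧ measureSize i p K' ≤ ‖c‖ * measureSize i p K := by
  have hsub : ∀ x, K ⊆ pConv p x → K' ⊆ pConv p (fun n => c • x n) := fun x hx y hy => by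
    obtain ⟨z, hz, rfl⟩ := hK y hy
    exact smul_mem_pConv (hx hz) c
  refine ⟨?_, ?_⟩
  · obtain ⟨x, hx, hKx⟩ := h
    exact ⟨_, hx.const_smul hp c, hsub x hKx⟩
  · have hlim : Tendsto (fun ε : ℝ => ‖c‖ * (measureSize i p K + ε)) (𝓝[>] 0)
        (𝓝 (‖c‖ * (measureSize i p K + 0))) :=
      ((Continuous.tendsto (by fun_prop) 0).mono_left nhdsWithin_le_nhds)
    rw [add_zero] at hlim
    refine ge_of_tendsto hlim ?_
    filter_upwards [self_mem_nhdsWithin] with ε (hε : 0 < ε)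
    obtain ⟨x, hx, hKx, hlt⟩ := h.exists_kindNorm_lt (lt_add_of_pos_right (measureSize i p K) hε)
    have h0 := measureSize_nonneg (i := i) (p := p) (K := K)
    refine (measureSize_le (hx.const_smul hp c) (hsub x hKx)).trans
      (ENNReal.toReal_le_of_le_ofReal (by positivity) ?_)
    refine (kindNorm_const_smul_le hp c x).trans ?_
    rw [ENNReal.ofReal_mul (norm_nonneg c), ofReal_norm]
    gcongr

end Measure

/-! ### The ideal norm on operators and its completeness -/

section OperatorIdeal

variable {X F : Type*} [NormedAddCommGroup X] [NormedSpace ℂ X] [NormedAddCommGroup F]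
  [NormedSpace ℂ F] {p : ℝ≥0∞} {i : Kind}

theorem norm_le_opIdealNorm (hp : 1 ≤ p) {T : X →L[ℂ] F} (hT : T ∈ opIdeal i p X F) :
    ‖T‖ ≤ opIdealNorm i p X F T :=
  T.opNorm_le_of_unit_norm measureSize_nonneg fun _ hx =>
    norm_le_measureSize hp hT (mem_image_of_mem T (by simp [hx]))

theorem zero_mem_opIdeal (hp : 1 ≤ p) : (0 : X →L[ℂ] F) ∈ opIdeal i p X F := by
  refine ⟨fun _ => 0, admissible_zero hp, ?_⟩
  rintro _ ⟨x, _, rfl⟩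
  exact zero_mem_pConv hp _

theorem smul_mem_opIdeal (hp : 1 ≤ p) (c : ℂ) {T : X →L[ℂ] F} (hT : T ∈ opIdeal i p X F) :
    c • T ∈ opIdeal i p X F ∧
      opIdealNorm i p X F (c • T) ≤ ‖c‖ * opIdealNorm i p X F T := by
  refine measureSize_smul_le hp hT c ?_
  rintro _ ⟨x, hx, rfl⟩
  exact ⟨T x, mem_image_of_mem T hx, rfl⟩

theorem add_mem_opIdeal [CompleteSpace F] (hp : 1 ≤ p) {S T : X →L[ℂ] F}
    (hS : S ∈ opIdeal i p X F) (hT : T ∈ opIdeal i p X F) :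
    S + T ∈ opIdeal i p X F ∧
      opIdealNorm i p X F (S + T) ≤ opIdealNorm i p X F S + opIdealNorm i p X F T := by
  refine measureSize_add_le hp hS hT ?_
  rintro _ ⟨x, hx, rfl⟩
  exact ⟨S x, mem_image_of_mem S hx, T x, mem_image_of_mem T hx, rfl⟩

/-- A sum of operators whose ideal norms decrease geometrically. -/
theorem mem_opIdeal_of_series [CompleteSpace F] (hp : 1 ≤ p) {S : ℕ → X →L[ℂ] F} {T : X →L[ℂ] F}
    {δ : ℝ} (hδ : 0 < δ) (hS : ∀ k, S k ∈ opIdeal i p X F)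
    (hSδ : ∀ k, opIdealNorm i p X F (S k) < δ * (1 / 4) ^ (k + 1))
    (hT : ∀ x, Tendsto (fun n => ∑ k ∈ Finset.range n, S k x) atTop (𝓝 (T x))) :
    T ∈ opIdeal i p X F ∧ opIdealNorm i p X F T ≤ δ := by
  choose x hx hKx hlt using fun k => RelCompact.exists_kindNorm_lt (hS k) (hSδ k)
  -- The bound `4^(-k-1)` splits as `2^(-k-1) · 2^(-k-1)`: one factor supplies the coefficients, the
  -- other the costs. The `ℓ_1` norm of a geometric sequence bounds its `ℓ_r` norm for every `r`.
  have hgeo : ∀ r : ℝ≥0∞, 1 ≤ r → ∀ C : ℝ, 0 ≤ C →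
      IsLpNull r (fun k => C * (1 / 2 : ℝ) ^ (k + 1)) ∧
        seqNorm r (fun k => C * (1 / 2 : ℝ) ^ (k + 1)) ≤ ENNReal.ofReal C := by
    intro r hr C hC
    have hsum : HasSum (fun k : ℕ => C * (1 / 2 : ℝ) ^ (k + 1)) C := by
      have := (hasSum_geometric_two' C)
      convert this using 2 with k
      rw [pow_succ, div_pow, one_pow]
      ring
    have h1 : seqNorm r (fun k => C * (1 / 2 : ℝ) ^ (k + 1)) ≤ ENNReal.ofReal C := by
      refine (seqNorm_le_tsum hr _).trans (le_of_eq ?_)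
      conv_rhs => rw [← hsum.tsum_eq]
      rw [ENNReal.ofReal_tsum_of_nonneg (fun k => by positivity) hsum.summable]
      exact tsum_congr fun k => by
        rw [← ofReal_norm, Real.norm_of_nonneg (by positivity)]
    exact ⟨⟨h1.trans_lt ENNReal.ofReal_lt_top, fun _ => hsum.summable.tendsto_atTop_zero⟩, h1⟩
  obtain ⟨hμ, hμδ⟩ := hgeo p hp δ hδ.le
  obtain ⟨hd, hd1⟩ := hgeo _ (one_le_conjExponent p) 1 zero_le_one
  have hc := ofReal_comp_mem_coeffBall hp hd (by simpa using hd1)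
  set c : ℕ → ℂ := fun k => ((1 * (1 / 2 : ℝ) ^ (k + 1) : ℝ) : ℂ) with hcdef
  have hc0 : ∀ k, c k ≠ 0 := fun k => Complex.ofReal_ne_zero.2 (by positivity)
  have res := measureSize_le_of_series (i := i) (K := T '' Metric.closedBall 0 1) hp
    (x := fun k n => (c k)⁻¹ • x k n) (fun k => (hx k).const_smul hp _) hμ (fun k => ?_) hc ?_
  · exact ⟨res.1, res.2.trans (ENNReal.toReal_le_of_le_ofReal hδ.le hμδ)⟩
  · refine (kindNorm_const_smul_le hp _ _).trans ((mul_le_mul_right (hlt k).le _).trans ?_)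
    rw [← ofReal_norm, ← ofReal_norm, ← ENNReal.ofReal_mul (norm_nonneg _)]
    refine ENNReal.ofReal_le_ofReal (le_of_eq ?_)
    rw [norm_inv, hcdef, Complex.norm_real, Real.norm_of_nonneg (by positivity),
      Real.norm_of_nonneg (by positivity), show (1 / 4 : ℝ) = 1 / 2 * (1 / 2) by norm_num,
      mul_pow]
    field_simp
  · rintro _ ⟨y, hy, rfl⟩
    refine ⟨fun k => (c k)⁻¹ • S k y,
      fun k => smul_mem_pConv (hKx k (mem_image_of_mem _ hy)) _, ?_⟩
    simpa only [smul_inv_smul₀ (hc0 _)] using hT y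

theorem isBanachOn_opIdeal [CompleteSpace F] (hp : 1 ≤ p) :
    IsBanachOn (opIdeal i p X F) (opIdealNorm i p X F) where
  zero_mem := zero_mem_opIdeal hp
  add_mem _ hS _ hT := (add_mem_opIdeal hp hS hT).1
  smul_mem c _ hT := (smul_mem_opIdeal hp c hT).1
  nonneg _ _ := measureSize_nonneg
  eq_zero_iff T hT := by
    refine ⟨fun h => norm_le_zero_iff.1 (h ▸ norm_le_opIdealNorm hp hT), ?_⟩
    rintro rfl
    refine le_antisymm ?_ measureSize_nonneg
    simpa using (smul_mem_opIdeal hp 0 (zero_mem_opIdeal (i := i) (X := X) (F := F) hp)).2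
  smul c T hT := by
    refine le_antisymm (smul_mem_opIdeal hp c hT).2 ?_
    by_cases hc : c = 0
    · rw [hc, norm_zero, zero_mul]
      exact measureSize_nonneg
    -- The reverse inequality is the direct one for `c⁻¹` applied to `c • T`.
    have h1 := smul_mem_opIdeal hp c hT
    have h2 := (smul_mem_opIdeal hp c⁻¹ h1.1).2
    rw [inv_smul_smul₀ hc, norm_inv] at h2
    rwa [← le_inv_mul_iff₀ (norm_pos_iff.2 hc)]
  triangle _ hS _ hT := (add_mem_opIdeal hp hS hT).2
  complete u hu hC := by
    have hsub : ∀ m n, u m - u n ∈ opIdeal i p X F := fun m n => by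
      have := (add_mem_opIdeal hp (hu m) (smul_mem_opIdeal hp (-1) (hu n)).1).1
      simpa [sub_eq_add_neg] using this
    have hcs : CauchySeq u := by
      rw [Metric.cauchySeq_iff]
      intro ε hε
      obtain ⟨N, hN⟩ := hC ε hε
      refine ⟨N, fun m hm n hn => ?_⟩
      rw [dist_eq_norm]
      exact (norm_le_opIdealNorm hp (hsub m n)).trans_lt (hN m hm n hn)
    obtain ⟨T, hT⟩ := cauchySeq_tendsto_of_complete hcs
    have key : ∀ δ > 0, ∃ N, ∀ m ≥ N,
        T - u m ∈ opIdeal i p X F ∧ opIdealNorm i p X F (T - u m) ≤ δ := by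
      intro δ hδ
      choose N hN using fun k : ℕ => hC (δ * (1 / 4) ^ (k + 1)) (by positivity)
      refine ⟨N 0, fun m hm => ?_⟩
      -- The indices satisfy `n 0 = m` and `n j ≥ N k` for `k ≤ j`. Hence `T - u m` is a telescoping
      -- series with terms of geometrically small ideal norm.
      set n : ℕ → ℕ := fun k => max (m + k) ((Finset.range (k + 1)).sup N) with hn
      have hn0 : n 0 = m := by simpa [hn] using hm
      have hnN : ∀ k j, k ≤ j → N k ≤ n j := fun k j hkj =>
        (Finset.le_sup (f := N) (Finset.mem_range.2 (Nat.lt_succ_of_le hkj))).trans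
          (le_max_right _ _)
      have hnt : Tendsto n atTop atTop :=
        tendsto_atTop_mono (fun k => (Nat.le_add_left k m).trans (le_max_left _ _)) tendsto_id
      refine mem_opIdeal_of_series hp (S := fun k => u (n (k + 1)) - u (n k)) hδ
        (fun k => hsub _ _) (fun k => hN k _ (hnN k _ (Nat.le_succ k)) _ (hnN k k le_rfl))
        fun x => ?_
      simp only [sub_apply]
      have htel : ∀ j, ∑ k ∈ Finset.range j, (u (n (k + 1)) x - u (n k) x) =
          u (n j) x - u m x := fun j => by
        rw [Finset.sum_range_sub (fun k => u (n k) x), hn0]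
      simp only [htel]
      have hTx : Tendsto (fun k => u k x) atTop (𝓝 (T x)) :=
        ((ContinuousLinearMap.apply ℂ F x).continuous.tendsto T).comp hT
      exact (hTx.comp hnt).sub_const _
    refine ⟨T, ?_, ?_⟩
    · obtain ⟨N, hN⟩ := key 1 one_pos
      have := (add_mem_opIdeal hp (hN N le_rfl).1 (hu N)).1
      rwa [sub_add_cancel] at this
    · rw [Metric.tendsto_atTop]
      intro ε hε
      obtain ⟨N, hN⟩ := key (ε / 2) (by positivity)
      refine ⟨N, fun m hm => ?_⟩
      obtain ⟨h1, h2⟩ := hN m hm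
      have h3 := (smul_mem_opIdeal hp (-1) h1).2
      have h4 : opIdealNorm i p X F (u m - T) ≤ ε / 2 := by
        simpa using h3.trans (by simpa using h2)
      rw [Real.dist_0_eq_abs,
        abs_of_nonneg (show 0 ≤ opIdealNorm i p X F (u m - T) from measureSize_nonneg)]
      linarith

end OperatorIdeal

/-! ### Local estimates for weighted holomorphic mappings -/

section Local

open Classical in
/-- The extension by zero of a mapping on `U`. -/
def extendZero {E : Type*} [TopologicalSpace E] {U : TopologicalSpace.Opens E} {Z : Type*}
    [Zero Z] (f : U → Z) (y : E) : Z := if h : y ∈ U then f ⟨y, h⟩ else 0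

theorem extendZero_of_mem {E : Type*} [TopologicalSpace E] {U : TopologicalSpace.Opens E}
    {Z : Type*} [Zero Z] (f : U → Z) {y : E} (h : y ∈ U) :
    extendZero f y = f ⟨y, h⟩ := dif_pos h

theorem extendZero_coe {E : Type*} [TopologicalSpace E] {U : TopologicalSpace.Opens E} {Z : Type*}
    [Zero Z] (f : U → Z) (y : U) : extendZero f (y : E) = f y :=
  dif_pos y.2

variable {E : Type*} [NormedAddCommGroup E] [NormedSpace ℂ E] {U : TopologicalSpace.Opens E}
  {v : Weight U} {F : Type*} [NormedAddCommGroup F] [NormedSpace ℂ F]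

theorem Hv.differentiableOn_extendZero (f : Hv v F) :
    DifferentiableOn ℂ (extendZero fun x => f x) (U : Set E) := by
  obtain ⟨g, hg, h⟩ := f.2.1
  exact hg.congr fun y hy => by rw [extendZero_of_mem _ hy]; exact (h ⟨y, hy⟩).symm

/-- By continuity the weight exceeds `v(x)/2` on a ball around `x`, so `|f| ≤ (2 / v(x)) ‖f‖` there.
-/
theorem exists_ball_bound (v : Weight U) (x : U) : ∃ r > 0, Metric.ball (x : E) r ⊆ U ∧
    ∃ M > 0, ∀ f : Hv v ℂ, ∀ y ∈ Metric.ball (x : E) r,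
      ‖extendZero (fun x => f x) y‖ ≤ M * ‖f‖ := by
  have hev : ∀ᶠ y in 𝓝 x, v.toFun x / 2 < v.toFun y :=
    (v.continuous_toFun.tendsto x).eventually_const_lt (half_lt_self (v.pos x))
  rw [nhds_subtype_eq_comap, eventually_comap] at hev
  obtain ⟨r, hr, h⟩ := Metric.eventually_nhds_iff_ball.1
    (hev.and (U.isOpen.mem_nhds x.2))
  refine ⟨r, hr, fun y hy => (h y hy).2, 2 / v.toFun x, div_pos two_pos (v.pos x),
    fun f y hy => ?_⟩
  have hy' := (h y hy).1 ⟨y, (h y hy).2⟩ rfl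
  rw [extendZero_of_mem _ (h y hy).2]
  have h1 := f.le_norm ⟨y, (h y hy).2⟩
  have h2 := mul_le_mul_of_nonneg_right hy'.le (norm_nonneg (f ⟨y, (h y hy).2⟩))
  have h3 := v.pos x
  rw [div_mul_eq_mul_div, le_div_iff₀ h3]
  linarith

/-- Schwarz estimates of first and second order, uniform on the unit ball. -/
theorem exists_schwarz_bounds (v : Weight U) (x : U) : ∃ r > 0, Metric.ball (x : E) r ⊆ U ∧
    ∃ C > 0, ∀ f : Hv v ℂ,
      (∀ y ∈ Metric.ball (x : E) r,
        ‖extendZero (fun x => f x) y - f x‖ ≤ C * ‖f‖ * ‖y - x‖) ∧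
      ‖fderiv ℂ (extendZero fun x => f x) x‖ ≤ C * ‖f‖ ∧
      (∀ y ∈ Metric.ball (x : E) r, ‖extendZero (fun x => f x) y - f x -
        fderiv ℂ (extendZero fun x => f x) x (y - x)‖ ≤ C * ‖f‖ * ‖y - x‖ ^ 2) := by
  obtain ⟨r, hr, hrU, M, hM, hb⟩ := exists_ball_bound v x
  refine ⟨r, hr, hrU, 2 * M / r + 4 * M / r ^ 2, by positivity, fun f => ?_⟩
  set g : E → ℂ := extendZero fun x => f x with hg
  have hgx : g x = f x := extendZero_coe _ x
  have hd : DifferentiableOn ℂ g (Metric.ball (x : E) r) :=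
    f.differentiableOn_extendZero.mono hrU
  have hfn := norm_nonneg f
  have hxb := Metric.mem_ball_self (x := (x : E)) hr
  have hmaps : MapsTo g (Metric.ball (x : E) r) (Metric.closedBall (g x) (2 * M * ‖f‖)) :=
    fun y hy => by
      rw [mem_closedBall_iff_norm]
      have := norm_sub_le (g y) (g x)
      have h1 := hb f y hy
      have h2 := hb f x hxb
      linarith
  have hder : ‖fderiv ℂ g x‖ ≤ 2 * M * ‖f‖ / r :=
    Complex.norm_fderiv_le_div_of_mapsTo_ball hd hmaps hr
  have hA : 0 ≤ 4 * M / r ^ 2 * ‖f‖ := by positivity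
  have hB : 0 ≤ 2 * M / r * ‖f‖ := by positivity
  refine ⟨fun y hy => ?_, ?_, fun y hy => ?_⟩
  · have h1 := Complex.dist_le_div_mul_dist_of_mapsTo_ball hd hmaps hy
    rw [dist_eq_norm, dist_eq_norm, hgx] at h1
    refine h1.trans (mul_le_mul_of_nonneg_right ?_ (norm_nonneg _))
    rw [add_mul]
    calc 2 * M * ‖f‖ / r = 2 * M / r * ‖f‖ := by ring
      _ ≤ _ := le_add_of_nonneg_right hA
  · rw [add_mul]
    calc ‖fderiv ℂ g x‖ ≤ 2 * M / r * ‖f‖ := hder.trans_eq (by ring)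
      _ ≤ _ := le_add_of_nonneg_right hA
  -- Removing the linear part at most doubles the bound `2M‖f‖`, and `k - k x` vanishes to first
  -- order, so the Schwarz lemma gains a second power of `‖y - x‖ / r`.
  · set k : E → ℂ := fun y => g y - fderiv ℂ g x (y - x) with hk
    have hkx : k x = g x := by simp [hk]
    have hkd : DifferentiableOn ℂ k (Metric.ball (x : E) r) :=
      hd.sub ((fderiv ℂ g x).differentiable.comp
        (differentiable_id.sub_const _)).differentiableOn
    have hkm : MapsTo k (Metric.ball (x : E) r) (Metric.closedBall (k x) (4 * M * ‖f‖)) :=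
      fun z hz => by
        rw [mem_closedBall_iff_norm, hkx]
        have h1 := mem_closedBall_iff_norm.1 (hmaps hz)
        have h2 : ‖fderiv ℂ g x (z - x)‖ ≤ 2 * M * ‖f‖ := by
          refine ((fderiv ℂ g x).le_opNorm _).trans ?_
          have h3 := (mem_ball_iff_norm.1 hz).le
          calc _ ≤ 2 * M * ‖f‖ / r * r := by gcongr
            _ = _ := by field_simp
        have h3 := norm_sub_le (g z - g x) (fderiv ℂ g x (z - x))
        have e : k z - g x = g z - g x - fderiv ℂ g x (z - x) := by simp only [hk]; ring
        rw [e]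
        linarith
    have hko : (fun w => k w - k x) =o[𝓝 (x : E)] fun w => ‖w - (x : E)‖ ^ 1 := by
      have h1 := (hd.differentiableAt (Metric.ball_mem_nhds _ hr)).hasFDerivAt.isLittleO
      simp only [pow_one]
      refine (h1.congr_left fun w => ?_).norm_right
      rw [hkx]
      simp only [hk]
      ring
    have h1 := Complex.dist_le_mul_div_pow_of_mapsTo_ball_of_isLittleO hkd hkm hko hy
    rw [dist_eq_norm, dist_eq_norm, hkx, hgx] at h1
    have e : g y - f x - fderiv ℂ g x (y - x) = k y - f x := by simp only [hk]; ring
    rw [e]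
    refine h1.trans ?_
    have hC := mul_nonneg hB (sq_nonneg ‖y - x‖)
    calc 4 * M * ‖f‖ * (‖y - x‖ / r) ^ (1 + 1) = 4 * M / r ^ 2 * ‖f‖ * ‖y - x‖ ^ 2 := by
          rw [div_pow]
          ring
      _ ≤ _ := by
        rw [add_mul, add_mul]
        linarith

end Local

/-! ### The predual `𝓖_v^∞(U)` -/

section Predual

variable {E : Type*} [NormedAddCommGroup E] [NormedSpace ℂ E] {U : TopologicalSpace.Opens E}
  {v : Weight U} {F : Type*} [NormedAddCommGroup F] [NormedSpace ℂ F]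

/-- The space `𝓖_v^∞(U)` as a normed space in its own right. -/
def Predual (v : Weight U) : Type _ := Gv v

instance : NormedAddCommGroup (Predual v) := inferInstanceAs (NormedAddCommGroup (Gv v))
instance : NormedSpace ℂ (Predual v) := inferInstanceAs (NormedSpace ℂ (Gv v))

/-- The inclusion of `𝓖_v^∞(U)` in the dual space. -/
def toDual (v : Weight U) : Predual v →ₗᵢ[ℂ] StrongDual ℂ (Hv v ℂ) := (Gv v).subtypeₗᵢ

theorem toDual_mem (φ : Predual v) : toDual v φ ∈ Gv v :=
  Subtype.coe_prop (S := (Gv v : Set (StrongDual ℂ (Hv v ℂ)))) φ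

/-- The evaluation at a point. -/
def eval (v : Weight U) (x : U) : Predual v := delta v x

theorem toDual_eval (x : U) (f : Hv v ℂ) : toDual v (eval v x) f = f x := rfl

/-- Norm convergence of functionals is uniform convergence on the unit ball, which preserves
continuity for the compact-open topology. -/
theorem isClosed_Gv (v : Weight U) : IsClosed (Gv v : Set (StrongDual ℂ (Hv v ℂ))) := by
  refine isClosed_of_closure_subset fun φ hφ => ?_
  let _ := ballCompactOpen v
  change Continuous fun f : Metric.closedBall (0 : Hv v ℂ) 1 => φ f.1
  refine continuous_of_uniform_approx_of_continuous fun u hu => ?_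
  obtain ⟨ε, hε, h⟩ := Metric.mem_uniformity_dist.1 hu
  obtain ⟨ψ, hψ, hd⟩ := Metric.mem_closure_iff.1 hφ ε hε
  refine ⟨fun f => ψ f.1, hψ, fun f => h ?_⟩
  rw [dist_eq_norm] at hd ⊢
  have hf : ‖f.1‖ ≤ 1 := mem_closedBall_zero_iff.1 f.2
  calc ‖φ f.1 - ψ f.1‖ = ‖(φ - ψ) f.1‖ := rfl
    _ ≤ ‖φ - ψ‖ * ‖f.1‖ := (φ - ψ).le_opNorm _
    _ ≤ ‖φ - ψ‖ := mul_le_of_le_one_right (norm_nonneg _) hf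
    _ < ε := hd

theorem norm_eval_le (v : Weight U) (x : U) : ‖eval v x‖ ≤ (v.toFun x)⁻¹ := by
  rw [← (toDual v).norm_map]
  refine ContinuousLinearMap.opNorm_le_bound _ (inv_nonneg.2 (v.pos x).le) fun f => ?_
  rw [toDual_eval, inv_mul_eq_div, le_div_iff₀ (v.pos x), mul_comm]
  exact f.le_norm x

theorem exists_compact_of_mem_Gv {φ : StrongDual ℂ (Hv v ℂ)} (hφ : φ ∈ Gv v) {ε : ℝ}
    (hε : 0 < ε) : ∃ K : Set U, IsCompact K ∧ ∃ η > 0, ∀ f : Hv v ℂ, ‖f‖ ≤ 1 →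
      (∀ x ∈ K, ‖f x‖ < η) → ‖φ f‖ < ε := by
  let t := ballCompactOpen v
  have hc : Continuous fun f : Metric.closedBall (0 : Hv v ℂ) 1 => φ f.1 := hφ
  have h0 : (0 : Hv v ℂ) ∈ Metric.closedBall (0 : Hv v ℂ) 1 := by simp
  have hmem := hc.continuousAt (x := ⟨0, h0⟩) |>.eventually (Metric.ball_mem_nhds _ hε)
  rw [nhds_induced, eventually_comap] at hmem
  obtain ⟨⟨K, η⟩, ⟨hK, hη⟩, hsub⟩ := (nhds_basis_uniformity'
    Metric.uniformity_basis_dist.compactConvergenceUniformity).mem_iff.1 hmem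
  refine ⟨K, hK, η, hη, fun f hf hfK => ?_⟩
  have h1 := hsub (a := ⟨fun x => f x, f.continuous_coe⟩) (fun x hx => by
      have h2 := hfK x hx
      have e : (0 : Hv v ℂ) x = 0 := rfl
      simpa [e] using h2) ⟨f, by simpa using hf⟩ rfl
  simpa using h1

/-- Continuity at `0` lets `φ` be controlled on a compact set. The unit ball is equicontinuous by
the first-order Schwarz estimate, so a finite net of zeros makes `f` smaller than `η` on that set;
homogeneity gives the factor `‖f‖`. -/
theorem exists_finset_of_mem_Gv {φ : StrongDual ℂ (Hv v ℂ)} (hφ : φ ∈ Gv v) {ε : ℝ}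
    (hε : 0 < ε) : ∃ t : Finset U, ∀ f : Hv v ℂ, (∀ x ∈ t, f x = 0) → ‖φ f‖ ≤ ε * ‖f‖ := by
  obtain ⟨K, hK, η, hη, h⟩ := exists_compact_of_mem_Gv hφ hε
  have hnhds : ∀ x : U, ∃ V ∈ 𝓝 x, ∀ y ∈ V, ∀ f : Hv v ℂ, ‖f‖ ≤ 1 → ‖f y - f x‖ < η := by
    intro x
    obtain ⟨r, hr, -, C, hC, hb⟩ := exists_schwarz_bounds v x
    refine ⟨{y | dist y x < min r (η / C)}, Metric.ball_mem_nhds x (by positivity),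
      fun y hy f hf => ?_⟩
    have hy1 : dist y x < r := lt_of_lt_of_le hy (min_le_left _ _)
    have hy2 : dist y x < η / C := lt_of_lt_of_le hy (min_le_right _ _)
    rw [Subtype.dist_eq, dist_eq_norm] at hy2
    have h1 := (hb f).1 y hy1
    rw [extendZero_coe] at h1
    refine h1.trans_lt ?_
    rw [lt_div_iff₀ hC] at hy2
    refine lt_of_le_of_lt ?_ hy2
    rw [mul_comm ‖_‖ C]
    gcongr
    exact mul_le_of_le_one_right hC.le hf
  choose V hV hVη using hnhds
  obtain ⟨t, -, ht⟩ := hK.elim_nhds_subcover V fun x _ => hV x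
  have key : ∀ f : Hv v ℂ, ‖f‖ ≤ 1 → (∀ x ∈ t, f x = 0) → ‖φ f‖ < ε := by
    intro f hf hft
    refine h f hf fun y hy => ?_
    obtain ⟨x, hx, hyx⟩ := mem_iUnion₂.1 (ht hy)
    simpa [hft x hx] using hVη x y hyx f hf
  refine ⟨t, fun f hf => ?_⟩
  by_cases hf0 : f = 0
  · simp [hf0]
  have hn : 0 < ‖f‖ := norm_pos_iff.2 hf0
  have h1 := key ((‖f‖ : ℂ)⁻¹ • f) (by rw [norm_smul, norm_inv]; simp [hn.ne']) fun x hx => by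
    change (‖f‖ : ℂ)⁻¹ • f x = 0
    rw [hf x hx, smul_zero]
  rw [map_smul, norm_smul, norm_inv, Complex.norm_real, norm_norm, inv_mul_lt_iff₀ hn] at h1
  linarith

/-- On the subspace `N` of functions vanishing on a suitable finite set, `φ` has norm at most `ε /
2`. Let `g` be a Hahn–Banach extension of that restriction; `φ - g` vanishes on `N`, so it is a
combination of finitely many evaluations at distance `‖g‖` from `φ`. -/
theorem dense_span_eval (v : Weight U) :
    Dense (Submodule.span ℂ (range (eval v)) : Set (Predual v)) := by
  intro φ
  refine Metric.mem_closure_iff.2 fun ε hε => ?_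
  obtain ⟨t, ht⟩ := exists_finset_of_mem_Gv (toDual_mem φ) (half_pos hε)
  set N : Submodule ℂ (Hv v ℂ) :=
    ⨅ x : t, LinearMap.ker (toDual v (eval v x.1)).toLinearMap with hN
  have hNmem : ∀ f ∈ N, ∀ x ∈ t, f x = 0 := fun f hf x hx => by
    have := (Submodule.mem_iInf _).1 hf ⟨x, hx⟩
    rwa [LinearMap.mem_ker] at this
  obtain ⟨g, hg, hgn⟩ := exists_extension_norm_eq N
    ((toDual v φ).comp N.subtypeL)
  have hgε : ‖g‖ ≤ ε / 2 := by
    rw [hgn]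
    exact ContinuousLinearMap.opNorm_le_bound _ (half_pos hε).le fun f =>
      ht f.1 (hNmem f.1 f.2)
  have hspan := mem_span_of_iInf_ker_le_ker
    (L := fun x : t => (toDual v (eval v x.1)).toLinearMap)
    (K := (toDual v φ - g).toLinearMap) fun f hf => by
      have := hg ⟨f, hf⟩
      rw [LinearMap.mem_ker]
      change toDual v φ f - g f = 0
      rw [this]
      exact sub_self _
  obtain ⟨c, hc⟩ := (Submodule.mem_span_range_iff_exists_fun ℂ).1 hspan
  refine ⟨∑ x : t, c x • eval v x.1, Submodule.sum_mem _ fun x _ =>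
    Submodule.smul_mem _ _ (Submodule.subset_span ⟨x.1, rfl⟩), ?_⟩
  have e : toDual v (φ - ∑ x : t, c x • eval v x.1) = g := by
    ext f
    have h1 := LinearMap.congr_fun hc f
    simp only [LinearMap.sum_apply, LinearMap.smul_apply] at h1
    simp only [map_sub, map_sum, map_smul, sub_apply, sum_apply, smul_apply]
    change ∑ x : t, c x • toDual v (eval v x.1) f = toDual v φ f - g f at h1
    rw [h1]
    ring
  rw [dist_eq_norm, ← (toDual v).norm_map, e]
  linarith

theorem ext_of_eval {S T : Predual v →L[ℂ] F} (h : ∀ x, S (eval v x) = T (eval v x)) : S = T :=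
  ContinuousLinearMap.ext_on (dense_span_eval v) (by rintro _ ⟨x, rfl⟩; exact h x)

/-- The evaluation mapping is holomorphic. -/
theorem differentiableOn_eval (v : Weight U) :
    DifferentiableOn ℂ (extendZero (eval v)) (U : Set E) := by
  intro x₀ hx₀
  set x : U := ⟨x₀, hx₀⟩
  obtain ⟨r, hr, hrU, C, hC, hb⟩ := exists_schwarz_bounds v x
  have hdiff : ∀ f : Hv v ℂ, DifferentiableAt ℂ (extendZero fun x => f x) (x : E) := fun f =>
    f.differentiableOn_extendZero.differentiableAt (U.isOpen.mem_nhds x.2)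
  -- The candidate derivative is `h ↦ (f ↦ Df(x) h)`. The second-order estimate, uniform in `f`,
  -- makes it the Fréchet derivative in the dual norm.
  let D₀ : E →ₗ[ℂ] Hv v ℂ →ₗ[ℂ] ℂ := LinearMap.mk₂ ℂ
    (fun h f => fderiv ℂ (extendZero fun x => f x) (x : E) h)
    (fun h₁ h₂ f => map_add _ h₁ h₂) (fun c h f => map_smul _ c h)
    (fun h f₁ f₂ => by
      have e : (extendZero fun x => (f₁ + f₂) x : E → ℂ) =
          (extendZero fun x => f₁ x) + extendZero fun x => f₂ x := by
        ext y
        by_cases hy : y ∈ U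
        · simp only [Pi.add_apply, extendZero_of_mem _ hy]; rfl
        · simp [extendZero, hy]
      rw [e, fderiv_add (hdiff f₁) (hdiff f₂)]
      rfl)
    (fun c h f => by
      have e : (extendZero fun x => (c • f) x : E → ℂ) = c • extendZero fun x => f x := by
        ext y
        by_cases hy : y ∈ U
        · simp only [Pi.smul_apply, extendZero_of_mem _ hy]; rfl
        · simp [extendZero, hy]
      rw [e, fderiv_const_smul (hdiff f)]
      rfl)
  let D : E →L[ℂ] StrongDual ℂ (Hv v ℂ) := D₀.mkContinuous₂ C fun h f => by
    refine ((fderiv ℂ (extendZero fun x => f x) (x : E)).le_opNorm h).trans ?_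
    have := mul_le_mul_of_nonneg_right (hb f).2.1 (norm_nonneg h)
    linarith
  have hD : ∀ h f, D h f = fderiv ℂ (extendZero fun x => f x) (x : E) h := fun h f => rfl
  have hbound : ∀ y ∈ Metric.ball (x : E) r,
      ‖toDual v (extendZero (eval v) y - eval v x) - D (y - x)‖ ≤ C * ‖y - x‖ ^ 2 := by
    intro y hy
    refine ContinuousLinearMap.opNorm_le_bound _ (by positivity) fun f => ?_
    have h1 := (hb f).2.2 y hy
    rw [extendZero_of_mem _ (hrU hy)] at h1 ⊢
    calc _ ≤ C * ‖f‖ * ‖y - x‖ ^ 2 := h1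
      _ = _ := by ring
  have hder : HasFDerivAt (fun y => toDual v (extendZero (eval v) y)) D x := by
    rw [hasFDerivAt_iff_isLittleO]
    refine Asymptotics.IsBigO.trans_isLittleO (g := fun y => ‖y - (x : E)‖ ^ 2) ?_ ?_
    · refine Asymptotics.IsBigO.of_bound C ?_
      filter_upwards [Metric.ball_mem_nhds (x : E) hr] with y hy
      have := hbound y hy
      rw [extendZero_coe]
      simpa using this
    · exact Asymptotics.isLittleO_pow_sub_sub (x : E) one_lt_two
  -- Directional derivatives are limits of difference quotients from the closed subspace `Gv v`, so
  -- the derivative takes its values there.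
  have hDmem : ∀ h, D h ∈ Gv v := fun h => by
    have hl : HasDerivAt (fun t : ℂ => toDual v (extendZero (eval v) ((x : E) + t • h)))
        (D h) 0 := hder.hasLineDerivAt h
    refine (isClosed_Gv v).mem_of_tendsto (hasDerivAt_iff_tendsto_slope.1 hl)
      (Eventually.of_forall fun t => ?_)
    rw [slope_def_module]
    exact (Gv v).smul_mem _ ((Gv v).sub_mem (toDual_mem _) (toDual_mem _))
  let D₁ : E →L[ℂ] Predual v := D.codRestrict (Gv v) hDmem
  have hD₁ : ∀ h, toDual v (D₁ h) = D h := fun h => rfl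
  refine (HasFDerivAt.differentiableAt (f' := D₁) ?_).differentiableWithinAt
  rw [hasFDerivAt_iff_isLittleO] at hder ⊢
  refine (hder.norm_left.congr_left fun y => ?_).of_norm_left
  rw [← hD₁, ← map_sub, ← map_sub, (toDual v).norm_map]

/-- The composition of a bounded operator on `𝓖_v^∞(U)` with the evaluation mapping. -/
def compEval (T : Predual v →L[ℂ] F) : Hv v F :=
  ⟨fun x => T (eval v x), ⟨fun y => T (extendZero (eval v) y),
    T.differentiable.comp_differentiableOn (differentiableOn_eval v),
    fun x => congrArg T (extendZero_coe _ x)⟩, ‖T‖, by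
      rintro _ ⟨x, rfl⟩
      have h1 := T.le_opNorm (eval v x)
      have h2 := norm_eval_le v x
      have h3 := v.pos x
      calc v.toFun x * ‖T (eval v x)‖ ≤ v.toFun x * (‖T‖ * (v.toFun x)⁻¹) := by
            gcongr
            exact h1.trans (by gcongr)
        _ = ‖T‖ := by field_simp⟩

theorem compEval_apply (T : Predual v →L[ℂ] F) (x : U) : compEval T x = T (eval v x) := rfl

/-- This is the predual property: each functional `l` on `G` is evaluation at the function `x ↦ l
(δ_x)`. Both sides are continuous in `φ` and agree on the evaluations. -/
theorem apply_compEval (l : StrongDual ℂ (Predual v)) (φ : Predual v) :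
    toDual v φ (compEval l) = l φ := by
  have : (ContinuousLinearMap.apply ℂ ℂ (compEval l)).comp (toDual v).toContinuousLinearMap = l :=
    ext_of_eval fun x => rfl
  exact DFunLike.congr_fun this φ

/-- The multiples `c v(x) δ_x` with `|c| ≤ 1`, and zero. -/
def weightedEvals (v : Weight U) : Set (Predual v) :=
  insert 0 {ψ | ∃ c : ℂ, ‖c‖ ≤ 1 ∧ ∃ x, ψ = c • (v.toFun x : ℂ) • eval v x}

/-- A functional `l` separating `φ` from the hull corresponds to a function of norm at most `s`, so
`|l φ| ≤ s`, a contradiction. Including `0` in the set forces `s > 0` even if `U` is empty. -/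
theorem closedBall_subset_closure_convexHull (v : Weight U) :
    Metric.closedBall (0 : Predual v) 1 ⊆ closure (convexHull ℝ (weightedEvals v)) := by
  intro φ hφ
  by_contra hcl
  obtain ⟨l, s, hs, hsφ⟩ := RCLike.geometric_hahn_banach_closed_point (𝕜 := ℂ)
    (convex_convexHull ℝ (weightedEvals v)).closure isClosed_closure hcl
  have hsub : weightedEvals v ⊆ closure (convexHull ℝ (weightedEvals v)) :=
    (subset_convexHull ℝ _).trans subset_closure
  have hs0 : 0 < s := by simpa using hs 0 (hsub (mem_insert _ _))
  have hnorm : ‖compEval l‖ ≤ s := by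
    refine Hv.norm_le hs0.le fun x => ?_
    rw [compEval_apply]
    -- A rotation `c` turns the bound on real parts into one on the modulus.
    obtain ⟨c, hc, hcl⟩ := RCLike.exists_norm_eq_mul_self (l ((v.toFun x : ℂ) • eval v x))
    have h1 := hs (c • (v.toFun x : ℂ) • eval v x) (hsub (Or.inr ⟨c, hc.le, x, rfl⟩))
    rw [map_smul, smul_eq_mul, ← hcl] at h1
    rw [map_smul, norm_smul, Complex.norm_real, Real.norm_of_nonneg (v.pos x).le] at h1
    simpa using h1.le
  have h1 : ‖l φ‖ ≤ s := by
    rw [← apply_compEval]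
    refine ((toDual v φ).le_opNorm _).trans ?_
    have h2 : ‖toDual v φ‖ ≤ 1 := by simpa using hφ
    calc _ ≤ 1 * s := by gcongr
      _ = s := one_mul s
  have h2 := Complex.re_le_norm (l φ)
  have h3 : s < (l φ).re := hsφ
  linarith

/-- A set which is closed under absolutely convex series and contains the values of an operator at
`v(x) δ_x` almost contains the image of the unit ball. -/
theorem smul_apply_mem_of_eval {T : Predual v →L[ℂ] F} {C : Set F} (h0 : (0 : F) ∈ C)
    (hbal : Balanced ℂ C) (hconv : Convex ℝ C)
    (hser : ∀ (c : ℕ → ℂ) (y : ℕ → F) (w : F), Summable (fun k => ‖c k‖) → ∑' k, ‖c k‖ ≤ 1 →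
      (∀ k, y k ∈ C) → HasSum (fun k => c k • y k) w → w ∈ C)
    (hT : ∀ x, (v.toFun x : ℂ) • T (eval v x) ∈ C) {φ : Predual v} (hφ : ‖φ‖ ≤ 1) {ε : ℝ}
    (hε : 0 < ε) (hε1 : ε < 1) : ((1 - ε : ℝ) : ℂ) • T φ ∈ C := by
  set A := convexHull ℝ (weightedEvals v) with hA
  have hTA : ∀ a ∈ A, T a ∈ C := by
    have : A ⊆ T ⁻¹' C := by
      refine convexHull_min ?_ (hconv.linear_preimage (T.restrictScalars ℝ).toLinearMap)
      rintro _ (rfl | ⟨c, hc, x, rfl⟩)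
      · simpa using h0
      · rw [mem_preimage, map_smul, map_smul]
        exact hbal.smul_mem hc (hT x)
    exact this
  have hstep : ∀ ψ : Metric.closedBall (0 : Predual v) 1, ∃ a ∈ A, ‖ψ.1 - a‖ < ε := fun ψ => by
    obtain ⟨a, ha, h⟩ := Metric.mem_closure_iff.1
      (closedBall_subset_closure_convexHull v ψ.2) ε hε
    exact ⟨a, ha, by rwa [dist_eq_norm] at h⟩
  choose a ha haε using hstep
  have hεc : (ε : ℂ) ≠ 0 := Complex.ofReal_ne_zero.2 hε.ne'
  -- The error of approximation by an element of `A` is below `ε`, so dividing it by `ε` returns to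
  -- the unit ball and the approximation can be iterated.
  let next : Metric.closedBall (0 : Predual v) 1 → Metric.closedBall (0 : Predual v) 1 := fun ψ =>
    ⟨(ε : ℂ)⁻¹ • (ψ.1 - a ψ), by
      rw [mem_closedBall_zero_iff, norm_smul, norm_inv, Complex.norm_real,
        Real.norm_of_nonneg hε.le, inv_mul_le_one₀ hε]
      exact (haε ψ).le⟩
  let ψ : ℕ → Metric.closedBall (0 : Predual v) 1 := fun k =>
    next^[k] ⟨φ, mem_closedBall_zero_iff.2 hφ⟩
  have hrec : ∀ k, (ψ k).1 = a (ψ k) + (ε : ℂ) • (ψ (k + 1)).1 := fun k => by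
    have e : ψ (k + 1) = next (ψ k) := Function.iterate_succ_apply' next k _
    rw [e]
    simp only [next]
    rw [smul_inv_smul₀ hεc, add_sub_cancel]
  have hpart : ∀ n, φ = ∑ k ∈ Finset.range n, (ε : ℂ) ^ k • a (ψ k) + (ε : ℂ) ^ n • (ψ n).1 := by
    intro n
    induction n with
    | zero => simp [ψ]
    | succ n ih =>
      rw [Finset.sum_range_succ, add_assoc, pow_succ, mul_smul, ← smul_add, ← hrec n]
      exact ih
  have hgeo := hasSum_geometric_of_lt_one hε.le hε1
  have hTn : ∀ k, ‖T (a (ψ k))‖ ≤ ‖T‖ * 2 := fun k => by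
    refine (T.le_opNorm _).trans ?_
    gcongr
    have h1 := haε (ψ k)
    have h2 : ‖(ψ k).1‖ ≤ 1 := mem_closedBall_zero_iff.1 (ψ k).2
    have h3 := norm_sub_le (ψ k).1 ((ψ k).1 - a (ψ k))
    rw [sub_sub_cancel] at h3
    linarith
  have hεn : ∀ k : ℕ, ‖(ε : ℂ) ^ k‖ = ε ^ k := fun k => by
    rw [norm_pow, Complex.norm_real, Real.norm_of_nonneg hε.le]
  have hpow : Tendsto (fun n : ℕ => ε ^ n) atTop (𝓝 0) :=
    tendsto_pow_atTop_nhds_zero_of_lt_one hε.le hε1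
  have hlim : Tendsto (fun n => ∑ k ∈ Finset.range n, (ε : ℂ) ^ k • T (a (ψ k))) atTop
      (𝓝 (T φ)) := by
    have h1 : ∀ n, ∑ k ∈ Finset.range n, (ε : ℂ) ^ k • T (a (ψ k)) =
        T φ - (ε : ℂ) ^ n • T (ψ n).1 := fun n => by
      conv_rhs => rw [hpart n]
      simp
    simp only [h1]
    have h2 : Tendsto (fun n => (ε : ℂ) ^ n • T (ψ n).1) atTop (𝓝 0) := by
      refine squeeze_zero_norm (a := fun n => ε ^ n * ‖T‖) (fun n => ?_)
        (by simpa using hpow.mul_const ‖T‖)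
      rw [norm_smul, hεn]
      gcongr
      exact (T.le_opNorm _).trans
        (mul_le_of_le_one_right (norm_nonneg _) (mem_closedBall_zero_iff.1 (ψ n).2))
    simpa using h2.const_sub (T φ)
  have hnsum : Summable fun k => ‖(ε : ℂ) ^ k • T (a (ψ k))‖ := by
    refine Summable.of_nonneg_of_le (fun _ => norm_nonneg _) (fun k => ?_)
      (hgeo.summable.mul_right (‖T‖ * 2))
    rw [norm_smul, hεn]
    gcongr
    exact hTn k
  have hsum : HasSum (fun k => (ε : ℂ) ^ k • T (a (ψ k))) (T φ) :=
    (hasSum_iff_tendsto_nat_of_summable_norm hnsum).2 hlim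
  -- The weights `ε^k` sum to `(1 - ε)⁻¹`; the factor `1 - ε` makes the series absolutely convex.
  have hc : HasSum (fun k => ‖((1 - ε : ℝ) : ℂ) * (ε : ℂ) ^ k‖) 1 := by
    have := hgeo.mul_left (1 - ε)
    rw [mul_inv_cancel₀ (by linarith)] at this
    have e : (fun k => ‖((1 - ε : ℝ) : ℂ) * (ε : ℂ) ^ k‖) = fun k => (1 - ε) * ε ^ k := by
      ext k
      rw [norm_mul, hεn, Complex.norm_real, Real.norm_of_nonneg (by linarith)]
    rwa [e]
  refine hser (fun k => ((1 - ε : ℝ) : ℂ) * (ε : ℂ) ^ k) (fun k => T (a (ψ k))) _ hc.summable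
    hc.tsum_eq.le (fun k => hTA _ (ha _)) ?_
  simpa only [mul_smul] using hsum.const_smul ((1 - ε : ℝ) : ℂ)

end Predual

/-! ### Linearization -/

section Linearization

variable {E : Type*} [NormedAddCommGroup E] [NormedSpace ℂ E] {U : TopologicalSpace.Opens E}
  {v : Weight U} {F : Type*} [NormedAddCommGroup F] [NormedSpace ℂ F]

/-- The composition of a functional with a weighted holomorphic mapping. -/
def dualComp (u : StrongDual ℂ F) (f : Hv v F) : Hv v ℂ :=
  ⟨fun x => u (f x), by
    obtain ⟨g, hg, h⟩ := f.2.1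
    exact ⟨fun y => u (g y), u.differentiable.comp_differentiableOn hg, fun x => congrArg u (h x)⟩,
    ‖u‖ * ‖f‖, by
      rintro _ ⟨x, rfl⟩
      have h1 := mul_le_mul_of_nonneg_left (u.le_opNorm (f x)) (v.pos x).le
      have h2 := mul_le_mul_of_nonneg_left (f.le_norm x) (norm_nonneg u)
      dsimp only
      linarith⟩

theorem norm_dualComp_le (u : StrongDual ℂ F) (f : Hv v F) : ‖dualComp u f‖ ≤ ‖u‖ * ‖f‖ := by
  refine Hv.norm_le (by positivity) fun x => ?_
  have h1 := mul_le_mul_of_nonneg_left (u.le_opNorm (f x)) (v.pos x).le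
  have h2 := mul_le_mul_of_nonneg_left (f.le_norm x) (norm_nonneg u)
  change v.toFun x * ‖u (f x)‖ ≤ _
  linarith

/-- The linearization of `f` with values in the bidual. -/
def bidualLinearization (f : Hv v F) : Predual v →L[ℂ] StrongDual ℂ (StrongDual ℂ F) :=
  LinearMap.mkContinuous₂
    (LinearMap.mk₂ ℂ (fun (φ : Predual v) u => toDual v φ (dualComp u f))
      (fun φ ψ u => by rw [map_add]; rfl) (fun c φ u => by rw [map_smul]; rfl)
      (fun φ u w => by
        rw [← map_add]
        rfl)
      (fun c φ u => by
        rw [← map_smul]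
        rfl)) ‖f‖ fun φ u => by
    refine ((toDual v φ).le_opNorm _).trans ?_
    rw [(toDual v).norm_map]
    have := mul_le_mul_of_nonneg_left (norm_dualComp_le u f) (norm_nonneg φ)
    linarith

/-- An operator that maps a dense subspace into an isometric copy of a Banach space factors through
that space. -/
theorem exists_lift_of_dense {X Z G : Type*} [NormedAddCommGroup X] [NormedSpace ℂ X]
    [NormedAddCommGroup Z] [NormedSpace ℂ Z] [NormedAddCommGroup G] [NormedSpace ℂ G]
    [CompleteSpace G] (j : G →ₗᵢ[ℂ] Z) (Φ : X →L[ℂ] Z) {S : Set X}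
    (hS : Dense (Submodule.span ℂ S : Set X)) (h : ∀ s ∈ S, Φ s ∈ range j) :
    ∃ T : X →L[ℂ] G, ∀ x, j (T x) = Φ x := by
  have hmem : ∀ x, Φ x ∈ LinearMap.range j.toLinearMap := by
    have hcl : IsClosed (Φ ⁻¹' range j) :=
      j.isometry.isClosedEmbedding.isClosed_range.preimage Φ.continuous
    have hsub : (Submodule.span ℂ S : Set X) ⊆ Φ ⁻¹' range j := by
      change Submodule.span ℂ S ≤ (LinearMap.range j.toLinearMap).comap Φ.toLinearMap
      exact Submodule.span_le.2 h
    exact fun x => closure_minimal hsub hcl (hS x)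
  refine ⟨(j.equivRange.symm.toContinuousLinearEquiv : _ →L[ℂ] G).comp (Φ.codRestrict _ hmem),
    fun x => ?_⟩
  exact congrArg Subtype.val (j.equivRange.apply_symm_apply ⟨Φ x, hmem x⟩)

/-- The bidual-valued operator sends `δ_x` to the canonical image of `f x`; density of the
evaluations and completeness of `F` bring all its values down to `F`. -/
theorem exists_linearization [CompleteSpace F] (f : Hv v F) :
    ∃ T : Predual v →L[ℂ] F, ∀ x, T (eval v x) = f x := by
  have h : ∀ φ ∈ range (eval v), bidualLinearization f φ ∈
      range (NormedSpace.inclusionInDoubleDualLi (E := F) ℂ) := by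
    rintro _ ⟨x, rfl⟩
    exact ⟨f x, rfl⟩
  obtain ⟨T, hT⟩ := exists_lift_of_dense (Z := StrongDual ℂ (StrongDual ℂ F))
    (NormedSpace.inclusionInDoubleDualLi ℂ) (bidualLinearization f) (dense_span_eval v) h
  exact ⟨T, fun x => (NormedSpace.inclusionInDoubleDualLi ℂ).injective (hT (eval v x))⟩

/-- The linearization operator. -/
def linearize [CompleteSpace F] : Hv v F →ₗ[ℂ] (Predual v →L[ℂ] F) where
  toFun f := (exists_linearization f).choose
  map_add' f g := ext_of_eval fun x => by
    rw [add_apply, (exists_linearization _).choose_spec,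
      (exists_linearization _).choose_spec, (exists_linearization _).choose_spec]
    rfl
  map_smul' c f := ext_of_eval fun x => by
    rw [RingHom.id_apply, smul_apply, (exists_linearization _).choose_spec,
      (exists_linearization _).choose_spec]
    rfl

variable [CompleteSpace F] {p : ℝ≥0∞} {i : Kind}

theorem linearize_eval (f : Hv v F) (x : U) : linearize f (eval v x) = f x :=
  (exists_linearization f).choose_spec x

theorem linearize_compEval (T : Predual v →L[ℂ] F) : linearize (compEval T) = T :=
  ext_of_eval fun x => linearize_eval _ x

theorem linearize_injective : Function.Injective (linearize : Hv v F →ₗ[ℂ] _) := fun f g h =>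
  Subtype.ext <| funext fun x => by
    have := DFunLike.congr_fun h (eval v x)
    rwa [linearize_eval, linearize_eval] at this

theorem vRange_subset (f : Hv v F) : vRange f ⊆ linearize f '' Metric.closedBall 0 1 := by
  rintro _ ⟨x, rfl⟩
  refine ⟨(v.toFun x : ℂ) • eval v x, ?_, by rw [map_smul, linearize_eval]⟩
  rw [mem_closedBall_zero_iff, norm_smul, Complex.norm_real, Real.norm_of_nonneg (v.pos x).le]
  calc v.toFun x * ‖eval v x‖ ≤ v.toFun x * (v.toFun x)⁻¹ :=
        mul_le_mul_of_nonneg_left (norm_eval_le v x) (v.pos x).le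
    _ = 1 := mul_inv_cancel₀ (v.pos x).ne'

theorem image_closedBall_subset_pConv (hp : 1 ≤ p) {f : Hv v F} {x : ℕ → F}
    (hx : weakSeqNorm p x < ∞) (hf : vRange f ⊆ pConv p x) {ε : ℝ} (hε : 0 < ε) (hε1 : ε < 1) :
    linearize f '' Metric.closedBall 0 1 ⊆
      pConv p (fun n => (((1 - ε : ℝ) : ℂ))⁻¹ • x n) := by
  rintro _ ⟨φ, hφ, rfl⟩
  have hbc := balanced_convex_pConv hp hx
  have h := smul_apply_mem_of_eval (T := linearize f) (zero_mem_pConv hp x) hbc.1 hbc.2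
    (fun c y w hc hc1 hy hw => hasSum_smul_mem_pConv hp hx hc hc1 hy hw)
    (fun x => hf ⟨x, by rw [linearize_eval]⟩) (mem_closedBall_zero_iff.1 hφ) hε hε1
  have h' := smul_mem_pConv h (((1 - ε : ℝ) : ℂ))⁻¹
  rwa [inv_smul_smul₀ (Complex.ofReal_ne_zero.2 (by linarith))] at h'

theorem mem_hvIdeal_iff (hp : 1 ≤ p) (f : Hv v F) :
    f ∈ hvIdeal i p v F ↔ linearize f ∈ opIdeal i p (Predual v) F := by
  refine ⟨fun ⟨x, hx, hf⟩ => ?_, fun h => RelCompact.mono h (vRange_subset f)⟩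
  -- Membership needs only one admissible `ε`; here `1/2`.
  exact ⟨_, hx.const_smul hp _, image_closedBall_subset_pConv hp hx.weakSeqNorm_lt_top hf
    (half_pos one_pos) one_half_lt_one⟩

theorem hvIdealNorm_eq (hp : 1 ≤ p) {f : Hv v F} (hf : f ∈ hvIdeal i p v F) :
    hvIdealNorm i p f = opIdealNorm i p (Predual v) F (linearize f) := by
  refine le_antisymm (measureSize_mono ((mem_hvIdeal_iff hp f).1 hf) (vRange_subset f)) ?_
  -- One `ε` serves both as the loss factor `(1 - ε)⁻¹` and as the slack in the infimum; both
  -- disappear in the limit.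
  have hlim : Tendsto (fun ε : ℝ => (1 - ε)⁻¹ * (hvIdealNorm i p f + ε)) (𝓝[>] 0)
      (𝓝 ((1 - 0)⁻¹ * (hvIdealNorm i p f + 0))) :=
    ((((continuous_const.sub continuous_id).tendsto (0 : ℝ)).inv₀ (by simp)).mul
      ((continuous_const.add continuous_id).tendsto 0)).mono_left nhdsWithin_le_nhds
  rw [sub_zero, inv_one, one_mul, add_zero] at hlim
  refine ge_of_tendsto hlim ?_
  filter_upwards [Ioo_mem_nhdsGT one_pos] with ε hε
  obtain ⟨x, hx, hfx, hlt⟩ := RelCompact.exists_kindNorm_lt hf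
    (lt_add_of_pos_right (hvIdealNorm i p f) hε.1)
  have h0 : 0 ≤ hvIdealNorm i p f := measureSize_nonneg
  have h1 : 0 < 1 - ε := by linarith [hε.2]
  have h2 := hε.1
  refine (measureSize_le (hx.const_smul hp _) (image_closedBall_subset_pConv hp
    hx.weakSeqNorm_lt_top hfx hε.1 hε.2)).trans
    (ENNReal.toReal_le_of_le_ofReal (by positivity) ?_)
  refine (kindNorm_const_smul_le hp _ x).trans ?_
  rw [ENNReal.ofReal_mul (by positivity), ← ofReal_norm, norm_inv, Complex.norm_real,
    Real.norm_of_nonneg h1.le]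
  gcongr

theorem bijOn_linearize (hp : 1 ≤ p) :
    Set.BijOn (linearize : Hv v F →ₗ[ℂ] _) (hvIdeal i p v F) (opIdeal i p (Predual v) F) := by
  refine ⟨fun f hf => (mem_hvIdeal_iff hp f).1 hf, linearize_injective.injOn, fun T hT => ?_⟩
  refine ⟨compEval T, (mem_hvIdeal_iff hp _).2 ?_, linearize_compEval T⟩
  rwa [linearize_compEval]

/-- The Banach space property is transported along linear isometric bijections. -/
theorem IsBanachOn.of_bijOn {X Y : Type*} [AddCommGroup X] [Module ℂ X] [AddCommGroup Y]
    [Module ℂ Y] {S : Set X} {S' : Set Y} {N : X → ℝ} {N' : Y → ℝ} (h : IsBanachOn S' N')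
    (L : X →ₗ[ℂ] Y) (hS : ∀ x, x ∈ S ↔ L x ∈ S') (hL : Set.BijOn L S S')
    (hN : ∀ x ∈ S, N x = N' (L x)) : IsBanachOn S N := by
  have hadd : ∀ x ∈ S, ∀ y ∈ S, x + y ∈ S := fun x hx y hy => by
    rw [hS, map_add]
    exact h.add_mem _ (hL.mapsTo hx) _ (hL.mapsTo hy)
  have hsmul : ∀ (c : ℂ), ∀ x ∈ S, c • x ∈ S := fun c x hx => by
    rw [hS, map_smul]
    exact h.smul_mem c _ (hL.mapsTo hx)
  have h0 : (0 : X) ∈ S := by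
    rw [hS, map_zero]
    exact h.zero_mem
  have hsub : ∀ x ∈ S, ∀ y ∈ S, x - y ∈ S := fun x hx y hy => by
    have := hadd x hx _ (hsmul (-1) y hy)
    rwa [neg_one_smul, ← sub_eq_add_neg] at this
  refine ⟨h0, hadd, hsmul, fun x hx => ?_, fun x hx => ?_, fun c x hx => ?_,
    fun x hx y hy => ?_, fun u hu hC => ?_⟩
  · rw [hN x hx]
    exact h.nonneg _ (hL.mapsTo hx)
  · rw [hN x hx, h.eq_zero_iff _ (hL.mapsTo hx), ← map_zero L]
    exact hL.injOn.eq_iff hx h0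
  · rw [hN _ (hsmul c x hx), hN x hx, map_smul]
    exact h.smul c _ (hL.mapsTo hx)
  · rw [hN _ (hadd x hx y hy), hN x hx, hN y hy, map_add]
    exact h.triangle _ (hL.mapsTo hx) _ (hL.mapsTo hy)
  · obtain ⟨y, hy, hlim⟩ := h.complete (fun n => L (u n)) (fun n => hL.mapsTo (hu n))
      fun ε hε => by
        obtain ⟨n₀, hn₀⟩ := hC ε hε
        refine ⟨n₀, fun m hm n hn => ?_⟩
        rw [← map_sub, ← hN _ (hsub _ (hu m) _ (hu n))]
        exact hn₀ m hm n hn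
    obtain ⟨x, hx, rfl⟩ := hL.surjOn hy
    refine ⟨x, hx, hlim.congr fun n => ?_⟩
    rw [hN _ (hsub _ (hu n) _ hx), map_sub]

end Linearization

end WeightedHolomorphic

end

open WeightedHolomorphic in
theorem theorem2p2 {E : Type*} [NormedAddCommGroup E] [NormedSpace ℂ E] [CompleteSpace E]
    {F : Type*} [NormedAddCommGroup F] [NormedSpace ℂ F] [CompleteSpace F]
    (U : TopologicalSpace.Opens E) (v : Weight U) (p : ℝ≥0∞) (hp : 1 ≤ p) (i : Kind) :
    -- `L f = T_f` is the unique linearization of `f`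
    ∃ L : Hv v F →ₗ[ℂ] (Gv v →L[ℂ] F),
      (∀ (f : Hv v F) (T : Gv v →L[ℂ] F), IsLinearization f T ↔ T = L f) ∧
      -- the equivalence, and equality of the norms
      (∀ f : Hv v F, f ∈ hvIdeal i p v F ↔ L f ∈ opIdeal i p (Gv v) F) ∧
      (∀ f ∈ hvIdeal i p v F, hvIdealNorm i p f = opIdealNorm i p (Gv v) F (L f)) ∧
      -- `f ↦ T_f` maps the one space onto the other, bijectively; both are Banach spaces
      Set.BijOn L (hvIdeal i p v F) (opIdeal i p (Gv v) F) ∧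
      IsBanachOn (opIdeal i p (Gv v) F) (opIdealNorm i p (Gv v) F) ∧
      IsBanachOn (hvIdeal i p v F) (hvIdealNorm i p) := by
  -- `Predual v` unfolds to `Gv v` with the same norm, so results about the former apply verbatim.
  refine ⟨(linearize : Hv v F →ₗ[ℂ] (Predual v →L[ℂ] F)), fun f T => ⟨fun h => ?_, ?_⟩,
    mem_hvIdeal_iff hp, fun f hf => hvIdealNorm_eq hp hf, bijOn_linearize hp,
    isBanachOn_opIdeal hp,
    (isBanachOn_opIdeal hp).of_bijOn linearize (mem_hvIdeal_iff hp) (bijOn_linearize hp)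
      fun f hf => hvIdealNorm_eq hp hf⟩
  · exact ext_of_eval (S := T) fun x => (h x).trans (linearize_eval f x).symm
  · rintro rfl
    exact linearize_eval f
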